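/- Let $L>1$ be an integer and let $a\in\mathbb R$ satisfy $a^2=2\pi L$. On $\mathcal H=L^2(\mathbb R)$, with inner product conjugate-linear in the first variable, let $\hat q$ be multiplication by $x$ on $\{f: xf\in L^2\}$ and $\hat p=-i\,d/dx$ on $\{f: f'\in L^2\}$ (weak derivative). Let $b=(\hat q+i\hat p)/\sqrt2$ on $D(\hat q)\cap D(\hat p)$, and let $T_1=e^{ia\hat q}$ (multiplication by $e^{iax}$) and $T_2=e^{-ia\hat p}$ (translation $f\mapsto f(\cdot-a)$). Let $\varphi_{0}(x)=\pi^{-1/4}e^{-x^2/2}$, and for $n=(n_1,n_2)\in\mathbb Z^2$ let $\varphi_n=T_1^{n_1}T_2^{n_2}\varphi_0$ and $z_n=\frac{a}{\sqrt2}(n_2+in_1)$. Let $h_L$ be the closed linear span of $\{\varphi_n\}_{n\in\mathbb Z^2}$. Put $$I_m=(-1)^{Lm_1m_2}e^{-\frac{\pi}{2}L(m_1^2+m_2^2)},\qquad F_L(P)=\sum_{m\in\mathbb Z^2}I_m e^{iP\cdot m},\qquad c_k=\frac1{(2\pi)^2}\int_0^{2\pi}\!\!\int_0^{2\pi}\frac{e^{-iP\cdot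 k}}{\sqrt{F_L(P)}}\,dP .$$ Then $b\varphi_0=0$, $\langle\varphi_m,\varphi_0\rangle=I_m$ for all $m\in\mathbb Z^2$, and the following hold. 1. $F_L(P)$ is real and strictly positive for every $P\in\mathbb R^2$, and $F_L^{-1/2}$ is $C^\infty$. For every $N\in\mathbb N$, $\|k\|^N|c_k|\to0$ as $\|k\|\to\infty$ in $\mathbb Z^2$; in particular $\sum_k|c_k|<\infty$. 2. The operator $X_L=\sum_{k\in\mathbb Z^2}c_kT_1^{k_1}T_2^{k_2}$ is bounded and self-adjoint on $\mathcal H$ and has a bounded inverse. Both $X_L$ and $X_L^{-1}$ map $h_L$ into itself. 3. The vectors $\Psi_n=X_L\varphi_n=\sum_{k\in\mathbb Z^2}c_k\varphi_{k+n}$, $n\in\mathbb Z^2$, lie in $h_L$ and are orthonormal. They satisfy $\Psi_n=T_1^{n_1}T_2^{n_2}\Psi_0$, $T_1\Psi_n=\Psi_{n+(1,0)}$ and $T_2\Psi_n=\Psi_{n+(0,1)}$. Their linear span is dense in $h_L$, so they form an orthonormal basis of $h_L$. 4. The operator $B_L=X_LbX_L^{-1}$, with domain $X_LD(b)$, is densely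 defined in $\mathcal H$. For every $n$, $\Psi_n\in D(B_L)$ and $B_L\Psi_n=z_n\Psi_n$. 5. Let $B_L^\dagger$ be the adjoint of $B_L$ in $\mathcal H$, and let $Q_L=(B_L+B_L^\dagger)/\sqrt2$ and $P_L=i(B_L^\dagger-B_L)/\sqrt2$. Sums and products of unbounded operators are taken on their natural domains. Then for every $n$ the vector $\Psi_n$ lies in the domains of $Q_L^2$, $P_L^2$ and $[B_L,B_L^\dagger]=B_LB_L^\dagger-B_L^\dagger B_L$. The variances $(\Delta A)^2=\langle\Psi_n,A^2\Psi_n\rangle-\langle\Psi_n,A\Psi_n\rangle^2$, $A=Q_L,P_L$, are real and nonnegative, and $$\Delta Q_L\cdot\Delta P_L=\tfrac12\langle\Psi_n,[B_L,B_L^\dagger]\Psi_n\rangle .$$ -/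

import Mathlib

open MeasureTheory Filter Topology
open scoped ENNReal ContDiff SchwartzMap InnerProductSpace

noncomputable section

namespace CoherentON

/-- The Hilbert space `L²(ℝ)` of the Schrödinger representation. -/
abbrev H : Type := Lp ℂ 2 (volume : Measure ℝ)

/-! ### The unitary groups `e^{it q}` and `e^{-it p}` -/

theorem memLp_modulation (t : ℝ) (f : H) :
    MemLp (fun x : ℝ => Complex.exp (Complex.I * t * x) * f x) 2 volume := by
  refine (Lp.memLp f).of_le ?_ ?_
  · exact (Continuous.aestronglyMeasurable (by fun_prop)).mul (Lp.aestronglyMeasurable f)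
  · refine Eventually.of_forall fun x => ?_
    have : Complex.I * t * x = ((t * x : ℝ) : ℂ) * Complex.I := by push_cast; ring
    rw [norm_mul, this, Complex.norm_exp_ofReal_mul_I, one_mul]

/-- The function `x ↦ e^{itx} f(x)`. -/
def modulationFun (t : ℝ) (f : H) : H := (memLp_modulation t f).toLp _

theorem coeFn_modulationFun (t : ℝ) (f : H) :
    modulationFun t f =ᵐ[volume] fun x : ℝ => Complex.exp (Complex.I * t * x) * f x :=
  MemLp.coeFn_toLp _

theorem modulationFun_neg_self (t : ℝ) (f : H) :
    modulationFun (-t) (modulationFun t f) = f := by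
  refine Lp.ext ?_
  filter_upwards [coeFn_modulationFun (-t) (modulationFun t f), coeFn_modulationFun t f]
    with x h1 h2
  rw [h1, h2, ← mul_assoc, ← Complex.exp_add]
  have : Complex.I * ((-t : ℝ) : ℂ) * x + Complex.I * t * x = 0 := by push_cast; ring
  rw [this, Complex.exp_zero, one_mul]

/-- The unitary operator `e^{it q}` on `L²(ℝ)`: multiplication by `x ↦ e^{itx}`. -/
def expQ (t : ℝ) : H ≃ₗᵢ[ℂ] H where
  toFun := modulationFun t
  invFun := modulationFun (-t)
  map_add' f g := by
    refine Lp.ext ?_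
    filter_upwards [coeFn_modulationFun t (f + g), coeFn_modulationFun t f,
      coeFn_modulationFun t g, Lp.coeFn_add f g,
      Lp.coeFn_add (modulationFun t f) (modulationFun t g)] with x h1 h2 h3 h4 h5
    rw [h1, h5, Pi.add_apply, h2, h3, h4, Pi.add_apply, mul_add]
  map_smul' c f := by
    refine Lp.ext ?_
    filter_upwards [coeFn_modulationFun t (c • f), coeFn_modulationFun t f,
      Lp.coeFn_smul c f, Lp.coeFn_smul c (modulationFun t f)] with x h1 h2 h3 h4
    simp only [RingHom.id_apply]
    rw [h1, h4, Pi.smul_apply, h2, h3, Pi.smul_apply, smul_eq_mul, smul_eq_mul]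
    ring
  left_inv f := modulationFun_neg_self t f
  right_inv f := by
    have := modulationFun_neg_self (-t) f
    rwa [neg_neg] at this
  norm_map' f := by
    change ‖modulationFun t f‖ = ‖f‖
    rw [Lp.norm_def, Lp.norm_def]
    congr 1
    refine eLpNorm_congr_norm_ae ?_
    filter_upwards [coeFn_modulationFun t f] with x h1
    have : Complex.I * t * x = ((t * x : ℝ) : ℂ) * Complex.I := by push_cast; ring
    rw [h1, norm_mul, this, Complex.norm_exp_ofReal_mul_I, one_mul]

/-- The unitary operator `e^{-it p}` on `L²(ℝ)`: the translation `f ↦ f(· - t)`. -/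
def expNegP (t : ℝ) : H ≃ₗᵢ[ℂ] H :=
  { Lp.compMeasurePreservingₗᵢ ℂ (fun x : ℝ => x - t) (measurePreserving_sub_right volume t) with
    invFun := Lp.compMeasurePreservingₗᵢ ℂ (fun x : ℝ => x + t)
      (measurePreserving_add_right volume t)
    left_inv := fun f => by
      change Lp.compMeasurePreserving (fun x : ℝ => x + t) (measurePreserving_add_right volume t)
        (Lp.compMeasurePreserving (fun x : ℝ => x - t)
          (measurePreserving_sub_right volume t) f) = f
      rw [← Lp.compMeasurePreserving_comp_apply]
      have e : ((fun x : ℝ => x - t) ∘ fun x : ℝ => x + t) = id := by ext x; simp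
      simp only [e, Lp.compMeasurePreserving_id_apply]
    right_inv := fun f => by
      change Lp.compMeasurePreserving (fun x : ℝ => x - t) (measurePreserving_sub_right volume t)
        (Lp.compMeasurePreserving (fun x : ℝ => x + t)
          (measurePreserving_add_right volume t) f) = f
      rw [← Lp.compMeasurePreserving_comp_apply]
      have e : ((fun x : ℝ => x + t) ∘ fun x : ℝ => x - t) = id := by ext x; simp
      simp only [e, Lp.compMeasurePreserving_id_apply] }

/-- `T₁ = e^{ia q}`. -/
def T₁ (a : ℝ) : H ≃ₗᵢ[ℂ] H := expQ a

/-- `T₂ = e^{-ia p}`. -/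
def T₂ (a : ℝ) : H ≃ₗᵢ[ℂ] H := expNegP a

/-- `T₁^{k₁} T₂^{k₂}` as a bounded operator. -/
def latticeOp (a : ℝ) (k : ℤ × ℤ) : H →L[ℂ] H :=
  ((T₁ a ^ k.1 * T₂ a ^ k.2 : H ≃ₗᵢ[ℂ] H) : H →L[ℂ] H)

/-! ### Unbounded operators: position, momentum, annihilation operator -/

/-- The position operator, `(q f)(x) = x f(x)`, on its maximal domain
`{f ∈ L² | x f(x) ∈ L²}`. -/
def position : H →ₗ.[ℂ] H where
  domain :=
    { carrier := {f | MemLp (fun x : ℝ => (x : ℂ) * f x) 2 volume}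
      zero_mem' := by
        refine (MemLp.zero (p := 2) (μ := (volume : Measure ℝ)) (ε := ℂ)).ae_eq ?_
        filter_upwards [Lp.coeFn_zero ℂ 2 (volume : Measure ℝ)] with x hx
        rw [hx]; simp
      add_mem' := fun {f g} hf hg => by
        refine (MemLp.add hf hg).ae_eq ?_
        filter_upwards [Lp.coeFn_add f g] with x hx
        rw [hx, Pi.add_apply, Pi.add_apply, mul_add]
      smul_mem' := fun c f hf => by
        refine (MemLp.const_smul hf c).ae_eq ?_
        filter_upwards [Lp.coeFn_smul c f] with x hx
        rw [hx, Pi.smul_apply, Pi.smul_apply, smul_eq_mul, smul_eq_mul]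
        ring }
  toFun :=
    { toFun := fun f => MemLp.toLp (fun x : ℝ => (x : ℂ) * (f : H) x) f.2
      map_add' := fun f g => by
        rw [← MemLp.toLp_add]
        refine MemLp.toLp_congr _ _ ?_
        filter_upwards [Lp.coeFn_add (f : H) (g : H)] with x hx
        rw [Submodule.coe_add, hx, Pi.add_apply, Pi.add_apply, mul_add]
      map_smul' := fun c f => by
        rw [RingHom.id_apply, ← MemLp.toLp_const_smul]
        refine MemLp.toLp_congr _ _ ?_
        filter_upwards [Lp.coeFn_smul c (f : H)] with x hx
        rw [Submodule.coe_smul, hx, Pi.smul_apply, Pi.smul_apply, smul_eq_mul, smul_eq_mul]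
        ring }

/-- `g ∈ L²` is the weak (distributional) derivative of `f ∈ L²`. -/
def IsWeakDeriv (f g : H) : Prop :=
  ∀ η : 𝓢(ℝ, ℂ), ∫ x, f x * deriv η x = -∫ x, g x * η x

theorem integrable_mul_schwartz (f : H) (η : 𝓢(ℝ, ℂ)) : Integrable (fun x => f x * η x) :=
  (Lp.memLp f).integrable_mul (η.memLp 2 volume)

theorem integrable_mul_deriv_schwartz (f : H) (η : 𝓢(ℝ, ℂ)) :
    Integrable (fun x => f x * deriv η x) :=
  integrable_mul_schwartz f (SchwartzMap.derivCLM ℂ ℂ η)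

theorem IsWeakDeriv.add {f g f' g' : H} (h : IsWeakDeriv f g) (h' : IsWeakDeriv f' g') :
    IsWeakDeriv (f + f') (g + g') := by
  intro η
  have e1 : ∫ x, (f + f' : H) x * deriv η x = ∫ x, (f x * deriv η x + f' x * deriv η x) := by
    refine integral_congr_ae ?_
    filter_upwards [Lp.coeFn_add f f'] with x hx
    rw [hx, Pi.add_apply, add_mul]
  have e2 : ∫ x, (g + g' : H) x * η x = ∫ x, (g x * η x + g' x * η x) := by
    refine integral_congr_ae ?_
    filter_upwards [Lp.coeFn_add g g'] with x hx
    rw [hx, Pi.add_apply, add_mul]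
  rw [e1, e2, integral_add (integrable_mul_deriv_schwartz f η) (integrable_mul_deriv_schwartz f' η),
    integral_add (integrable_mul_schwartz g η) (integrable_mul_schwartz g' η), h η, h' η]
  ring

theorem IsWeakDeriv.smul (c : ℂ) {f g : H} (h : IsWeakDeriv f g) :
    IsWeakDeriv (c • f) (c • g) := by
  intro η
  have e1 : ∫ x, (c • f : H) x * deriv η x = ∫ x, c * (f x * deriv η x) := by
    refine integral_congr_ae ?_
    filter_upwards [Lp.coeFn_smul c f] with x hx
    rw [hx, Pi.smul_apply, smul_eq_mul, mul_assoc]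
  have e2 : ∫ x, (c • g : H) x * η x = ∫ x, c * (g x * η x) := by
    refine integral_congr_ae ?_
    filter_upwards [Lp.coeFn_smul c g] with x hx
    rw [hx, Pi.smul_apply, smul_eq_mul, mul_assoc]
  rw [e1, e2, integral_const_mul, integral_const_mul, h η]
  ring

theorem isWeakDeriv_zero : IsWeakDeriv 0 0 := by
  intro η
  have e (u : ℝ → ℂ) : ∫ x, (0 : H) x * u x = 0 := by
    rw [← integral_zero ℝ ℂ]
    refine integral_congr_ae ?_
    filter_upwards [Lp.coeFn_zero ℂ 2 (volume : Measure ℝ)] with x hx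
    rw [hx]; simp
  rw [e, e, neg_zero]

theorem IsWeakDeriv.unique {f g g' : H} (h : IsWeakDeriv f g) (h' : IsWeakDeriv f g') :
    g = g' := by
  refine Lp.ext (ae_eq_of_integral_contDiff_smul_eq
    ((Lp.memLp g).locallyIntegrable one_le_two) ((Lp.memLp g').locallyIntegrable one_le_two) ?_)
  intro u hu hs
  have hs' : HasCompactSupport (fun x => (u x : ℂ)) := hs.comp_left (g := fun y : ℝ => (y : ℂ)) rfl
  have hu' : ContDiff ℝ ∞ (fun x => (u x : ℂ)) := Complex.ofRealCLM.contDiff.comp hu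
  have key : ∀ k : H, ∫ x, u x • k x = ∫ x, k x * (hs'.toSchwartzMap hu') x := by
    intro k
    refine integral_congr_ae (Eventually.of_forall fun x => ?_)
    simp [mul_comm]
  rw [key, key, ← neg_inj, ← h, ← h']

/-- The momentum operator `p f = -i f'` on the Sobolev space
`{f ∈ L² | f has a weak derivative f' ∈ L²}`. -/
def momentum : H →ₗ.[ℂ] H where
  domain :=
    { carrier := {f | ∃ g, IsWeakDeriv f g}
      zero_mem' := ⟨0, isWeakDeriv_zero⟩
      add_mem' := fun ⟨g, hg⟩ ⟨g', hg'⟩ => ⟨g + g', hg.add hg'⟩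
      smul_mem' := fun c _ ⟨g, hg⟩ => ⟨c • g, hg.smul c⟩ }
  toFun :=
    { toFun := fun f => -Complex.I • f.2.choose
      map_add' := fun f g => by
        rw [← smul_add, (f + g).2.choose_spec.unique (f.2.choose_spec.add g.2.choose_spec)]
      map_smul' := fun c f => by
        rw [RingHom.id_apply, smul_comm c,
          (c • f).2.choose_spec.unique (f.2.choose_spec.smul c)] }

/-- The annihilation operator `b = (q + i p)/√2`, with domain `D(q) ∩ D(p)`. -/
def annihilation : H →ₗ.[ℂ] H :=
  ((1 / Real.sqrt 2 : ℝ) : ℂ) • (position + Complex.I • momentum)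

/-- The composition `A B` of unbounded operators, on its natural domain
`{x ∈ D(B) | B x ∈ D(A)}`. -/
def pcomp (A B : H →ₗ.[ℂ] H) : H →ₗ.[ℂ] H where
  domain :=
    { carrier := {x | ∃ h : x ∈ B.domain, B ⟨x, h⟩ ∈ A.domain}
      zero_mem' := ⟨B.domain.zero_mem, by
        have : B ⟨0, B.domain.zero_mem⟩ = 0 := B.map_zero
        rw [this]; exact A.domain.zero_mem⟩
      add_mem' := fun {x y} ⟨hx, hx'⟩ ⟨hy, hy'⟩ => ⟨B.domain.add_mem hx hy, by
        have : B ⟨x + y, B.domain.add_mem hx hy⟩ = B ⟨x, hx⟩ + B ⟨y, hy⟩ :=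
          B.map_add ⟨x, hx⟩ ⟨y, hy⟩
        rw [this]; exact A.domain.add_mem hx' hy'⟩
      smul_mem' := fun c x ⟨hx, hx'⟩ => ⟨B.domain.smul_mem c hx, by
        have : B ⟨c • x, B.domain.smul_mem c hx⟩ = c • B ⟨x, hx⟩ := B.map_smul c ⟨x, hx⟩
        rw [this]; exact A.domain.smul_mem c hx'⟩ }
  toFun :=
    { toFun := fun x => A ⟨B ⟨x, x.2.1⟩, x.2.2⟩
      map_add' := fun x y => by
        rw [← A.map_add]
        congr 1
        exact Subtype.ext (B.map_add ⟨x, x.2.1⟩ ⟨y, y.2.1⟩)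
      map_smul' := fun c x => by
        rw [RingHom.id_apply, ← A.map_smul]
        congr 1
        exact Subtype.ext (B.map_smul c ⟨x, x.2.1⟩) }

/-- A bounded operator regarded as an everywhere defined partial operator. -/
def ofBounded (X : H →L[ℂ] H) : H →ₗ.[ℂ] H := (X : H →ₗ[ℂ] H).toPMap ⊤

/-- The commutator `[A, B] = A B - B A` on its natural domain. -/
def comm (A B : H →ₗ.[ℂ] H) : H →ₗ.[ℂ] H := pcomp A B - pcomp B A

open Classical in
/-- The expectation value `⟨ψ, A ψ⟩` (set to `0` outside the domain of `A`). -/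
def expect (A : H →ₗ.[ℂ] H) (ψ : H) : ℂ :=
  if h : ψ ∈ A.domain then ⟪ψ, A ⟨ψ, h⟩⟫_ℂ else 0

/-- The variance `⟨A²⟩ - ⟨A⟩²` in the state `ψ`. -/
def variance (A : H →ₗ.[ℂ] H) (ψ : H) : ℂ := expect (pcomp A A) ψ - expect A ψ ^ 2

/-- The uncertainty `ΔA`, with `(ΔA)² = ⟨A²⟩ - ⟨A⟩²`. -/
def uncertainty (A : H →ₗ.[ℂ] H) (ψ : H) : ℝ := Real.sqrt (variance A ψ).re

/-! ### Coherent states -/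

theorem memLp_vacuum :
    MemLp (fun x : ℝ => ((Real.pi ^ (-(1 / 4) : ℝ) * Real.exp (-x ^ 2 / 2) : ℝ) : ℂ)) 2 volume := by
  refine MemLp.ofReal (MemLp.const_mul ?_ _)
  rw [memLp_two_iff_integrable_sq (by fun_prop)]
  refine (integrable_exp_neg_mul_sq one_pos).congr (Eventually.of_forall fun x => ?_)
  simp only [← Real.exp_nat_mul]
  congr 1
  push_cast
  ring

/-- The normalized vacuum `φ₀(x) = π^{-1/4} e^{-x²/2}` of `b`. -/
def vacuum : H := memLp_vacuum.toLp _

/-- The coherent states `φ_n = T₁^{n₁} T₂^{n₂} φ₀`. -/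
def φ (a : ℝ) (n : ℤ × ℤ) : H := latticeOp a n vacuum

/-- `z_n = (a/√2) (n₂ + i n₁)`. -/
def z (a : ℝ) (n : ℤ × ℤ) : ℂ := ((a / Real.sqrt 2 : ℝ) : ℂ) * (n.2 + Complex.I * n.1)

/-- `h_L`, the closed linear span of the coherent states. -/
def hL (a : ℝ) : Submodule ℂ H := (Submodule.span ℂ (Set.range (φ a))).topologicalClosure

/-! ### The orthonormalization -/

/-- `I_m = (-1)^{L m₁ m₂} e^{-(π/2) L (m₁² + m₂²)}`. -/
def I (L : ℕ) (m : ℤ × ℤ) : ℂ :=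
  (-1) ^ ((L : ℤ) * m.1 * m.2) *
    (Real.exp (-(Real.pi / 2) * L * ((m.1 : ℝ) ^ 2 + (m.2 : ℝ) ^ 2)) : ℂ)

/-- `F_L(P) = ∑_m I_m e^{i P·m}`. -/
def F (L : ℕ) (P : ℝ × ℝ) : ℂ :=
  ∑' m : ℤ × ℤ, I L m * Complex.exp (Complex.I * (P.1 * m.1 + P.2 * m.2))

/-- `F_L(P)^{-1/2}`; here `F_L(P)` is a positive real number. -/
def C (L : ℕ) (P : ℝ × ℝ) : ℝ := 1 / Real.sqrt (F L P).re

/-- `c_k = (2π)^{-2} ∫_0^{2π} ∫_0^{2π} e^{-iP·k} F_L(P)^{-1/2} dP`. -/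
def c (L : ℕ) (k : ℤ × ℤ) : ℂ :=
  1 / (2 * Real.pi) ^ 2 * ∫ P₁ in (0 : ℝ)..(2 * Real.pi), ∫ P₂ in (0 : ℝ)..(2 * Real.pi),
    Complex.exp (-Complex.I * (P₁ * k.1 + P₂ * k.2)) * C L (P₁, P₂)

/-- `X_L = ∑_k c_k T₁^{k₁} T₂^{k₂}`, a norm-convergent series. -/
def X (a : ℝ) (L : ℕ) : H →L[ℂ] H := ∑' k : ℤ × ℤ, c L k • latticeOp a k

/-- `Ψ_n = X_L φ_n`. -/
def Ψ (a : ℝ) (L : ℕ) (n : ℤ × ℤ) : H := X a L (φ a n)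

/-- `B_L = X_L b X_L^{-1}`, with domain `X_L D(b)` when `X_L` is invertible. -/
def B (a : ℝ) (L : ℕ) : H →ₗ.[ℂ] H :=
  pcomp (ofBounded (X a L)) (pcomp annihilation (ofBounded (Ring.inverse (X a L))))

/-- `Q_L = (B_L + B_L†)/√2`. -/
def Q (a : ℝ) (L : ℕ) : H →ₗ.[ℂ] H :=
  ((1 / Real.sqrt 2 : ℝ) : ℂ) • (B a L + (B a L).adjoint)

/-- `P_L = i (B_L† - B_L)/√2`. -/
def P (a : ℝ) (L : ℕ) : H →ₗ.[ℂ] H :=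
  (Complex.I * ((1 / Real.sqrt 2 : ℝ) : ℂ)) • ((B a L).adjoint - B a L)

end CoherentON

end

noncomputable section

namespace CoherentON

/-! ### Rapidly decaying families on `ℤ²` and their convolution -/

/-! Because `a ^ 2 = 2πL` with `L` an integer, the phase `e^{ia²}` by which `T₁` and `T₂` fail to
commute is 1, so `latticeOp a` is a unitary representation of `ℤ²`. For any bounded representation
`u`, the map `f ↦ ∑ f_k u_k` (`synth u`) turns convolution into products. It is applied twice, to
the characters `chr p` and to `latticeOp a`. On the torus it is injective (`eq_of_synth_chr_eq`), so
an identity between functions of `P` gives one between coefficients, and hence one between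
operators.

The function identity is `F^{-1/2} F^{-1/2} F = 1`. It gives `c * c * I = δ` (`conv_conv_c_c_I`),
hence `X² S = 1` with `S` the operator with coefficients `I`. As `X` and `S` are self-adjoint, `X`
is invertible, with inverse the operator with coefficients `c * I`. Since `⟨φ_m, φ_n⟩ = I_{m-n}`,
the Gram matrix `⟨φ_i, X² φ_j⟩` of the `Ψ_n` is `(c * c * I)(i - j) = δ_{ij}`. Density holds because
`X` and `X⁻¹` are both norm limits of combinations of lattice operators.

The analytic input is that the off-diagonal overlaps are small. With the weight `2^{|m|}` their sum
is at most `9/16 < 1`, so `F = 1 + G` is positive and the binomial series of `(1 + G)^{-1/2}`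
converges in a weighted convolution norm. Its coefficients decay geometrically, and by uniqueness of
Fourier coefficients they are the `c_k` (`rapidDecay_c_and_synth_chr_c`).

For `B = X b X⁻¹`, the eigenvalue equation is carried over by similarity from `b φ_n = z_n φ_n`. The
uncertainty equality is a fact about any unit eigenvector `ψ` of a densely defined `A` for which `u
= A†ψ` exists and lies in both domains: the two variances and half of `⟨[A, A†]⟩` all equal `(‖u‖² -
|ζ|²)/2` (`uncertainty_of_eigenvector`). It remains to check domains. Moving `b` or its adjoint past
a lattice operator costs a scalar that is linear in `k`, and rapidly decaying coefficients absorb it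
(`rel_synth`, `exists_maps_adjoint_B_Ψ`). -/

/-- The `ℓ¹` length of a lattice vector. -/
def len (k : ℤ × ℤ) : ℕ := k.1.natAbs + k.2.natAbs

theorem len_add_le (k l : ℤ × ℤ) : len (k + l) ≤ len k + len l := by
  have h1 := Int.natAbs_add_le k.1 l.1
  have h2 := Int.natAbs_add_le k.2 l.2
  simp only [len, Prod.fst_add, Prod.snd_add]
  omega

theorem len_neg (k : ℤ × ℤ) : len (-k) = len k := by
  simp [len]

/-- Families on `ℤ²` that are summable against every polynomial weight. -/
def RapidDecay (f : ℤ × ℤ → ℂ) : Prop :=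
  ∀ N : ℕ, Summable fun k => (1 + len k : ℝ) ^ N * ‖f k‖

theorem RapidDecay.summable_norm {f : ℤ × ℤ → ℂ} (hf : RapidDecay f) :
    Summable fun k => ‖f k‖ := by
  simpa using hf 0

theorem summable_int_pow_mul_geometric {r : ℝ} (h0 : 0 ≤ r) (h1 : r < 1) (N : ℕ) :
    Summable fun n : ℤ => (1 + n.natAbs : ℝ) ^ N * r ^ n.natAbs := by
  have h : Summable fun n : ℕ => (1 + n : ℝ) ^ N * r ^ n := by
    have e : ∀ n : ℕ, (1 + n : ℝ) ^ N * r ^ n =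
        ∑ i ∈ Finset.range (N + 1), (N.choose i : ℝ) * ((n : ℝ) ^ i * r ^ n) := by
      intro n
      rw [add_comm, add_pow, Finset.sum_mul]
      refine Finset.sum_congr rfl fun i _ => ?_
      rw [one_pow]; ring
    simp_rw [e]
    refine summable_sum fun i _ => Summable.mul_left _ ?_
    exact summable_pow_mul_geometric_of_norm_lt_one i (by rwa [Real.norm_of_nonneg h0])
  refine Summable.of_nat_of_neg ?_ ?_ <;> simpa using h

theorem summable_pow_len_mul_geometric {r : ℝ} (h0 : 0 ≤ r) (h1 : r < 1) (N : ℕ) :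
    Summable fun k : ℤ × ℤ => (1 + len k : ℝ) ^ N * r ^ len k := by
  have hs := summable_int_pow_mul_geometric h0 h1 N
  have := hs.mul_of_nonneg hs (fun _ => by positivity) (fun _ => by positivity)
  refine Summable.of_nonneg_of_le (fun _ => by positivity) (fun k => ?_) this
  have : (1 + len k : ℝ) ≤ (1 + k.1.natAbs) * (1 + k.2.natAbs) := by
    simp only [len, Nat.cast_add]
    nlinarith [mul_nonneg (Nat.cast_nonneg (α := ℝ) k.1.natAbs)
      (Nat.cast_nonneg (α := ℝ) k.2.natAbs)]
  calc (1 + len k : ℝ) ^ N * r ^ len k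
      ≤ ((1 + k.1.natAbs) * (1 + k.2.natAbs)) ^ N * r ^ len k := by gcongr
    _ = _ := by rw [mul_pow, len, pow_add]; ring

theorem summable_geometric_len {r : ℝ} (h0 : 0 ≤ r) (h1 : r < 1) :
    Summable fun k : ℤ × ℤ => r ^ len k := by
  simpa using summable_pow_len_mul_geometric h0 h1 0

theorem RapidDecay.of_le_geometric {f : ℤ × ℤ → ℂ} {M r : ℝ} (h0 : 0 ≤ r) (h1 : r < 1)
    (hf : ∀ k, ‖f k‖ ≤ M * r ^ len k) : RapidDecay f := fun N => by
  refine Summable.of_nonneg_of_le (fun _ => by positivity) (fun k => ?_)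
    ((summable_pow_len_mul_geometric h0 h1 N).mul_left M)
  calc (1 + len k : ℝ) ^ N * ‖f k‖ ≤ (1 + len k : ℝ) ^ N * (M * r ^ len k) := by gcongr; exact hf k
    _ = _ := by ring

theorem RapidDecay.of_norm_le_mul {f g : ℤ × ℤ → ℂ} (hf : RapidDecay f) {M : ℝ}
    (h : ∀ k, ‖g k‖ ≤ M * (1 + len k) * ‖f k‖) : RapidDecay g := fun N => by
  refine Summable.of_nonneg_of_le (fun _ => by positivity) (fun k => ?_) ((hf (N + 1)).mul_left M)
  calc (1 + len k : ℝ) ^ N * ‖g k‖ ≤ (1 + len k : ℝ) ^ N * (M * (1 + len k) * ‖f k‖) := by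
        gcongr; exact h k
    _ = _ := by ring

theorem RapidDecay.fst_mul {f : ℤ × ℤ → ℂ} (hf : RapidDecay f) :
    RapidDecay fun k => (k.1 : ℂ) * f k := by
  refine hf.of_norm_le_mul (M := 1) fun k => ?_
  rw [norm_mul, Complex.norm_intCast, one_mul]
  gcongr
  have : |(k.1 : ℝ)| = (k.1.natAbs : ℝ) := by rw [Nat.cast_natAbs, Int.cast_abs]
  rw [this, len, Nat.cast_add]
  linarith [Nat.cast_nonneg (α := ℝ) k.2.natAbs]

theorem RapidDecay.snd_mul {f : ℤ × ℤ → ℂ} (hf : RapidDecay f) :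
    RapidDecay fun k => (k.2 : ℂ) * f k := by
  refine hf.of_norm_le_mul (M := 1) fun k => ?_
  rw [norm_mul, Complex.norm_intCast, one_mul]
  gcongr
  have : |(k.2 : ℝ)| = (k.2.natAbs : ℝ) := by rw [Nat.cast_natAbs, Int.cast_abs]
  rw [this, len, Nat.cast_add]
  linarith [Nat.cast_nonneg (α := ℝ) k.1.natAbs]

theorem RapidDecay.tendsto {f : ℤ × ℤ → ℂ} (hf : RapidDecay f) (N : ℕ) :
    Tendsto (fun k : ℤ × ℤ => Real.sqrt ((k.1 : ℝ) ^ 2 + (k.2 : ℝ) ^ 2) ^ N * ‖f k‖)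
      cofinite (𝓝 0) := by
  refine squeeze_zero (fun _ => by positivity) (fun k => ?_) (hf N).tendsto_cofinite_zero
  gcongr
  refine Real.sqrt_le_iff.2 ⟨by positivity, ?_⟩
  have h1 : (k.1 : ℝ) ^ 2 = (k.1.natAbs : ℝ) ^ 2 := by
    rw [Nat.cast_natAbs, Int.cast_abs, sq_abs]
  have h2 : (k.2 : ℝ) ^ 2 = (k.2.natAbs : ℝ) ^ 2 := by
    rw [Nat.cast_natAbs, Int.cast_abs, sq_abs]
  rw [h1, h2, len, Nat.cast_add]
  have h3 := Nat.cast_nonneg (α := ℝ) k.1.natAbs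
  have h4 := Nat.cast_nonneg (α := ℝ) k.2.natAbs
  nlinarith [mul_nonneg h3 h4]

/-- Convolution of families on `ℤ²`. -/
def conv (f g : ℤ × ℤ → ℂ) (k : ℤ × ℤ) : ℂ := ∑' m, f m * g (k - m)

/-- The bijection `(k, m) ↦ (m, k - m)`. -/
def shearEquiv : (ℤ × ℤ) × (ℤ × ℤ) ≃ (ℤ × ℤ) × (ℤ × ℤ) where
  toFun p := (p.2, p.1 - p.2)
  invFun p := (p.1 + p.2, p.1)
  left_inv p := by simp
  right_inv p := by simp

/-- The weight is submultiplicative by the triangle inequality for `len`, so after the shear the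
family is dominated by a product of two summable ones. -/
theorem RapidDecay.summable_conv {f g : ℤ × ℤ → ℂ} (hf : RapidDecay f) (hg : RapidDecay g)
    (N : ℕ) : Summable fun p : (ℤ × ℤ) × (ℤ × ℤ) =>
      (1 + len p.1 : ℝ) ^ N * ‖f p.2 * g (p.1 - p.2)‖ := by
  have h := (hf N).mul_of_nonneg (hg N) (fun _ => by positivity) (fun _ => by positivity)
  refine Summable.of_nonneg_of_le (fun _ => by positivity) (fun p => ?_)
    (shearEquiv.summable_iff.2 h)
  have : (1 + len p.1 : ℝ) ≤ (1 + len p.2) * (1 + len (p.1 - p.2)) := by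
    have h1 := len_add_le p.2 (p.1 - p.2)
    rw [add_sub_cancel] at h1
    have h2 : (len p.1 : ℝ) ≤ len p.2 + len (p.1 - p.2) := mod_cast h1
    nlinarith [mul_nonneg (Nat.cast_nonneg (α := ℝ) (len p.2))
      (Nat.cast_nonneg (α := ℝ) (len (p.1 - p.2)))]
  calc (1 + len p.1 : ℝ) ^ N * ‖f p.2 * g (p.1 - p.2)‖
      ≤ ((1 + len p.2) * (1 + len (p.1 - p.2))) ^ N * ‖f p.2 * g (p.1 - p.2)‖ := by gcongr
    _ = _ := by rw [norm_mul, mul_pow]; simp only [Function.comp, shearEquiv, Equiv.coe_fn_mk]; ring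

theorem RapidDecay.summable_norm_conv {f g : ℤ × ℤ → ℂ} (hf : RapidDecay f) (hg : RapidDecay g) :
    Summable fun p : (ℤ × ℤ) × (ℤ × ℤ) => ‖f p.2 * g (p.1 - p.2)‖ := by
  simpa using hf.summable_conv hg 0

theorem RapidDecay.conv {f g : ℤ × ℤ → ℂ} (hf : RapidDecay f) (hg : RapidDecay g) :
    RapidDecay (conv f g) := fun N => by
  refine Summable.of_nonneg_of_le (fun _ => by positivity) (fun k => ?_)
    (hf.summable_conv hg N).prod
  dsimp only
  rw [tsum_mul_left]
  gcongr
  exact norm_tsum_le_tsum_norm ((hf.summable_norm_conv hg).prod_factor k)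

/-! ### Synthesis of absolutely convergent series over `ℤ²` -/

section Synth

variable {A : Type*} [NormedRing A] [NormedAlgebra ℂ A]

/-- The series `∑_k f_k u_k`. -/
def synth (u : ℤ × ℤ → A) (f : ℤ × ℤ → ℂ) : A := ∑' k, f k • u k

theorem norm_smul_le_of_norm_le_one {u : ℤ × ℤ → A} (hu : ∀ k, ‖u k‖ ≤ 1) (f : ℤ × ℤ → ℂ)
    (k : ℤ × ℤ) : ‖f k • u k‖ ≤ ‖f k‖ := by
  rw [norm_smul]
  exact mul_le_of_le_one_right (norm_nonneg _) (hu k)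

theorem summable_norm_synth {u : ℤ × ℤ → A} (hu : ∀ k, ‖u k‖ ≤ 1) {f : ℤ × ℤ → ℂ}
    (hf : Summable fun k => ‖f k‖) : Summable fun k => ‖f k • u k‖ :=
  Summable.of_nonneg_of_le (fun _ => norm_nonneg _) (norm_smul_le_of_norm_le_one hu f) hf

theorem hasSum_synth [CompleteSpace A] {u : ℤ × ℤ → A} (hu : ∀ k, ‖u k‖ ≤ 1) {f : ℤ × ℤ → ℂ}
    (hf : Summable fun k => ‖f k‖) : HasSum (fun k => f k • u k) (synth u f) :=
  (summable_norm_synth hu hf).of_norm.hasSum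

/-- Cauchy product, regrouped along the shear by the total index. The algebra is left general so
that the result serves both scalars and operators. -/
theorem synth_conv [CompleteSpace A] {u : ℤ × ℤ → A} (hu : ∀ k, ‖u k‖ ≤ 1)
    (hmul : ∀ k l, u (k + l) = u k * u l) {f g : ℤ × ℤ → ℂ} (hf : RapidDecay f)
    (hg : RapidDecay g) : synth u (conv f g) = synth u f * synth u g := by
  have hs : Summable fun p : (ℤ × ℤ) × (ℤ × ℤ) => (f p.2 * g (p.1 - p.2)) • u p.1 := by
    refine Summable.of_norm (Summable.of_nonneg_of_le (fun _ => norm_nonneg _) (fun p => ?_)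
      (hf.summable_norm_conv hg))
    rw [norm_smul]
    exact mul_le_of_le_one_right (norm_nonneg _) (hu _)
  rw [synth, synth, synth, tsum_mul_tsum_of_summable_norm (summable_norm_synth hu hf.summable_norm)
    (summable_norm_synth hu hg.summable_norm), ← shearEquiv.tsum_eq]
  have e : ∀ p : (ℤ × ℤ) × (ℤ × ℤ), f (shearEquiv p).1 • u (shearEquiv p).1 *
      g (shearEquiv p).2 • u (shearEquiv p).2 = (f p.2 * g (p.1 - p.2)) • u p.1 := by
    intro p
    simp only [shearEquiv, Equiv.coe_fn_mk]
    rw [smul_mul_smul_comm, ← hmul, add_sub_cancel]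
  simp_rw [e]
  rw [hs.tsum_prod]
  refine tsum_congr fun k => ?_
  have := ((hf.summable_norm_conv hg).prod_factor k).of_norm
  dsimp only at this ⊢
  rw [this.tsum_smul_const]
  rfl

theorem synth_single (u : ℤ × ℤ → A) : synth u (Pi.single 0 1) = u 0 := by
  rw [synth, tsum_eq_single 0 (fun k hk => by simp [hk])]
  simp

end Synth

/-! ### Convolution powers -/

/-- The `j`-fold convolution power. -/
def convPow (g : ℤ × ℤ → ℂ) : ℕ → ℤ × ℤ → ℂ
  | 0 => Pi.single 0 1
  | j + 1 => conv g (convPow g j)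

/-- Weighted Young inequality: `2^{len}` is submultiplicative, so convolution by `g` acts on the
weighted sup norm with norm at most the weighted `ℓ¹` norm `ρ` of `g`. -/
theorem norm_conv_le {g f : ℤ × ℤ → ℂ} {ρ M : ℝ} (hM : 0 ≤ M)
    (hg : HasSum (fun k => 2 ^ len k * ‖g k‖) ρ) (hf : ∀ k, ‖f k‖ ≤ M * (1 / 2) ^ len k)
    (k : ℤ × ℤ) : ‖conv g f k‖ ≤ ρ * M * (1 / 2) ^ len k := by
  have hb : ∀ m, ‖g m * f (k - m)‖ ≤ M * (1 / 2) ^ len k * (2 ^ len m * ‖g m‖) := by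
    intro m
    have h1 : len k ≤ len m + len (k - m) := by
      have := len_add_le m (k - m)
      rwa [add_sub_cancel] at this
    have h2 : ((1 : ℝ) / 2) ^ len (k - m) ≤ (1 / 2) ^ len k * 2 ^ len m := by
      have h3 : ((1 : ℝ) / 2) ^ (len m + len (k - m)) ≤ (1 / 2) ^ len k :=
        pow_le_pow_of_le_one (by norm_num) (by norm_num) h1
      calc ((1 : ℝ) / 2) ^ len (k - m)
          = (1 / 2) ^ (len m + len (k - m)) * 2 ^ len m := by
            rw [pow_add, mul_right_comm, ← mul_pow]; norm_num
        _ ≤ _ := by gcongr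
    calc ‖g m * f (k - m)‖ = ‖g m‖ * ‖f (k - m)‖ := norm_mul _ _
      _ ≤ ‖g m‖ * (M * ((1 / 2) ^ len k * 2 ^ len m)) := by
        gcongr
        exact (hf _).trans (by gcongr)
      _ = _ := by ring
  refine (tsum_of_norm_bounded (hg.mul_left _) hb).trans (le_of_eq (by ring))

theorem norm_convPow_le {g : ℤ × ℤ → ℂ} {ρ : ℝ} (hg : HasSum (fun k => 2 ^ len k * ‖g k‖) ρ)
    (j : ℕ) (k : ℤ × ℤ) : ‖convPow g j k‖ ≤ ρ ^ j * (1 / 2) ^ len k := by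
  have hρ : 0 ≤ ρ := hg.nonneg fun _ => by positivity
  induction j generalizing k with
  | zero =>
    rw [pow_zero, one_mul]
    by_cases hk : k = 0
    · subst hk; simp [convPow, len]
    · simp [convPow, hk]
  | succ j ih =>
    rw [pow_succ']
    exact norm_conv_le (by positivity) hg ih k

theorem rapidDecay_convPow {g : ℤ × ℤ → ℂ} {ρ : ℝ} (hg : HasSum (fun k => 2 ^ len k * ‖g k‖) ρ)
    (j : ℕ) : RapidDecay (convPow g j) :=
  RapidDecay.of_le_geometric (by norm_num) (by norm_num) (norm_convPow_le hg j)

theorem synth_convPow {A : Type*} [NormedRing A] [NormedAlgebra ℂ A] [CompleteSpace A]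
    {u : ℤ × ℤ → A} (hu : ∀ k, ‖u k‖ ≤ 1) (hmul : ∀ k l, u (k + l) = u k * u l) (h0 : u 0 = 1)
    {g : ℤ × ℤ → ℂ} {ρ : ℝ} (hg : HasSum (fun k => 2 ^ len k * ‖g k‖) ρ) (hg' : RapidDecay g)
    (j : ℕ) : synth u (convPow g j) = synth u g ^ j := by
  induction j with
  | zero => rw [convPow, synth_single, h0, pow_zero]
  | succ j ih => rw [convPow, synth_conv hu hmul hg' (rapidDecay_convPow hg j), ih, pow_succ']

/-- The family of coefficients of `∑_j a_j G^j`, where `g` is the family of coefficients of `G`. -/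
def convSeries (a : ℕ → ℂ) (g : ℤ × ℤ → ℂ) (k : ℤ × ℤ) : ℂ := ∑' j, a j * convPow g j k

theorem norm_convSeries_le {a : ℕ → ℂ} {g : ℤ × ℤ → ℂ} {ρ M : ℝ}
    (hg : HasSum (fun k => 2 ^ len k * ‖g k‖) ρ) (ha : HasSum (fun j => ‖a j‖ * ρ ^ j) M)
    (k : ℤ × ℤ) : ‖convSeries a g k‖ ≤ M * (1 / 2) ^ len k := by
  refine tsum_of_norm_bounded (ha.mul_right _) fun j => ?_
  rw [norm_mul, mul_assoc]
  gcongr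
  exact norm_convPow_le hg j k

/-- Functional calculus by power series: the bound `ρ ^ j * (1 / 2) ^ len k` makes the double series
absolutely convergent, so the sums over `j` and `k` may be exchanged. -/
theorem synth_convSeries {A : Type*} [NormedRing A] [NormedAlgebra ℂ A] [CompleteSpace A]
    {u : ℤ × ℤ → A} (hu : ∀ k, ‖u k‖ ≤ 1) (hmul : ∀ k l, u (k + l) = u k * u l) (h0 : u 0 = 1)
    {a : ℕ → ℂ} {g : ℤ × ℤ → ℂ} {ρ : ℝ} (hg : HasSum (fun k => 2 ^ len k * ‖g k‖) ρ)
    (hg' : RapidDecay g) (ha : Summable (fun j => ‖a j‖ * ρ ^ j)) :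
    synth u (convSeries a g) = ∑' j, a j • synth u g ^ j := by
  have hρ : 0 ≤ ρ := hg.nonneg fun _ => by positivity
  have hn : ∀ j k, ‖a j * convPow g j k‖ ≤ ‖a j‖ * ρ ^ j * (1 / 2) ^ len k := by
    intro j k
    rw [norm_mul, mul_assoc]
    gcongr
    exact norm_convPow_le hg j k
  have hs : Summable fun p : (ℤ × ℤ) × ℕ => (a p.2 * convPow g p.2 p.1) • u p.1 := by
    have := (summable_geometric_len (r := 1 / 2) (by norm_num) (by norm_num)).mul_of_nonneg ha
      (fun _ => by positivity) (fun _ => by positivity)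
    refine Summable.of_norm (Summable.of_nonneg_of_le (fun _ => norm_nonneg _) (fun p => ?_) this)
    rw [norm_smul]
    refine (mul_le_of_le_one_right (norm_nonneg _) (hu _)).trans ((hn _ _).trans_eq (mul_comm _ _))
  have h1 : ∀ k, convSeries a g k • u k = ∑' j, (a j * convPow g j k) • u k := by
    intro k
    have : Summable fun j => a j * convPow g j k :=
      Summable.of_norm (Summable.of_nonneg_of_le (fun _ => norm_nonneg _) (fun j => hn j k)
        (ha.mul_right _))
    rw [this.tsum_smul_const]
    rfl
  rw [synth]
  simp_rw [h1]
  rw [← Summable.tsum_comm (f := fun k j => (a j * convPow g j k) • u k) hs]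
  refine tsum_congr fun j => ?_
  simp_rw [mul_smul]
  rw [Summable.tsum_const_smul _ (hasSum_synth hu (rapidDecay_convPow hg j).summable_norm).summable,
    ← synth_convPow hu hmul h0 hg hg' j]
  rfl

/-! ### Fourier series on the two-dimensional torus -/

/-- The character `k ↦ e^{iP·k}` of `ℤ²`. -/
def chr (p : ℝ × ℝ) (k : ℤ × ℤ) : ℂ := Complex.exp (Complex.I * (p.1 * k.1 + p.2 * k.2))

theorem norm_chr (p : ℝ × ℝ) (k : ℤ × ℤ) : ‖chr p k‖ = 1 := by
  have : Complex.I * (p.1 * k.1 + p.2 * k.2 : ℂ) =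
    ((p.1 * k.1 + p.2 * k.2 : ℝ) : ℂ) * Complex.I := by push_cast; ring
  rw [chr, this, Complex.norm_exp_ofReal_mul_I]

theorem norm_chr_le (p : ℝ × ℝ) (k : ℤ × ℤ) : ‖chr p k‖ ≤ 1 := (norm_chr p k).le

theorem chr_add (p : ℝ × ℝ) (k l : ℤ × ℤ) : chr p (k + l) = chr p k * chr p l := by
  rw [chr, chr, chr, ← Complex.exp_add]
  congr 1
  push_cast [Prod.fst_add, Prod.snd_add]
  ring

theorem chr_zero (p : ℝ × ℝ) : chr p 0 = 1 := by simp [chr]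

theorem conj_chr (p : ℝ × ℝ) (k : ℤ × ℤ) : starRingEnd ℂ (chr p k) = chr p (-k) := by
  rw [chr, chr, ← Complex.exp_conj]
  congr 1
  simp
  ring

theorem integral_exp_int (n : ℤ) :
    ∫ x in (0 : ℝ)..(2 * Real.pi), Complex.exp (Complex.I * (n * x)) =
      if n = 0 then 2 * Real.pi else 0 := by
  split_ifs with h
  · subst h; simp
  · have hc : Complex.I * n ≠ 0 := mul_ne_zero Complex.I_ne_zero (Int.cast_ne_zero.2 h)
    simp_rw [← mul_assoc]
    rw [integral_exp_mul_complex hc]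
    have : Complex.I * n * ((2 * Real.pi : ℝ) : ℂ) = n * (2 * Real.pi * Complex.I) := by
      push_cast; ring
    rw [this, Complex.exp_int_mul_two_pi_mul_I]
    simp

theorem hasSum_intervalIntegral_of_norm_le {ι : Type*} [Countable ι] {f : ι → ℝ → ℂ} {v : ι → ℝ}
    (hf : ∀ i, Continuous (f i)) (hv : Summable v) (hfv : ∀ i x, ‖f i x‖ ≤ v i) (x y : ℝ) :
    HasSum (fun i => ∫ t in x..y, f i t) (∫ t in x..y, ∑' i, f i t) :=
  intervalIntegral.hasSum_integral_of_dominated_convergence (fun i _ => v i)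
    (fun i => (hf i).aestronglyMeasurable) (fun i => Eventually.of_forall fun t _ => hfv i t)
    (Eventually.of_forall fun _ _ => hv) intervalIntegrable_const
    (Eventually.of_forall fun t _ => (hv.of_norm_bounded fun i => hfv i t).hasSum)

/-- Absolute convergence permits integration term by term, one variable at a time, and orthogonality
of exponentials leaves the single term `m = k`. -/
theorem fourierCoeff_synth {f : ℤ × ℤ → ℂ} (hf : Summable fun k => ‖f k‖) (k : ℤ × ℤ) :
    1 / (2 * Real.pi) ^ 2 * ∫ P₁ in (0 : ℝ)..(2 * Real.pi), ∫ P₂ in (0 : ℝ)..(2 * Real.pi),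
      Complex.exp (-Complex.I * (P₁ * k.1 + P₂ * k.2)) * synth (chr (P₁, P₂)) f = f k := by
  have hexp : ∀ (n : ℤ) (x : ℝ), ‖Complex.exp (Complex.I * (n * x))‖ = 1 := by
    intro n x
    have : Complex.I * (n * x : ℂ) = ((n * x : ℝ) : ℂ) * Complex.I := by push_cast; ring
    rw [this, Complex.norm_exp_ofReal_mul_I]
  have hinner : ∀ P₁ : ℝ, ∫ P₂ in (0 : ℝ)..(2 * Real.pi),
      Complex.exp (-Complex.I * (P₁ * k.1 + P₂ * k.2)) * synth (chr (P₁, P₂)) f =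
      ∑' m : ℤ × ℤ, f m * (if m.2 - k.2 = 0 then 2 * Real.pi else 0) *
        Complex.exp (Complex.I * ((m.1 - k.1 : ℤ) * P₁)) := by
    intro P₁
    have h := hasSum_intervalIntegral_of_norm_le (f := fun (m : ℤ × ℤ) (P₂ : ℝ) =>
      f m * Complex.exp (Complex.I * ((m.1 - k.1 : ℤ) * P₁)) *
        Complex.exp (Complex.I * ((m.2 - k.2 : ℤ) * P₂))) (by fun_prop) hf
      (fun m x => by rw [norm_mul, norm_mul, hexp, hexp, mul_one, mul_one]) 0 (2 * Real.pi)
    have e : ∀ P₂ : ℝ, Complex.exp (-Complex.I * (P₁ * k.1 + P₂ * k.2)) * synth (chr (P₁, P₂)) f =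
        ∑' m : ℤ × ℤ, f m * Complex.exp (Complex.I * ((m.1 - k.1 : ℤ) * P₁)) *
        Complex.exp (Complex.I * ((m.2 - k.2 : ℤ) * P₂)) := by
      intro P₂
      rw [synth, ← tsum_mul_left]
      refine tsum_congr fun m => ?_
      rw [smul_eq_mul, chr, mul_left_comm, mul_assoc, ← Complex.exp_add, ← Complex.exp_add]
      congr 2
      push_cast
      ring
    simp_rw [e, ← h.tsum_eq, intervalIntegral.integral_const_mul, integral_exp_int]
    refine tsum_congr fun m => ?_
    ring
  simp_rw [hinner]
  have hb : ∀ m : ℤ × ℤ, ‖f m * ((if m.2 - k.2 = 0 then 2 * Real.pi else 0 : ℝ) : ℂ)‖ ≤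
      ‖f m‖ * (2 * Real.pi) := by
    intro m
    rw [norm_mul]
    gcongr
    split_ifs
    · simp [abs_of_pos Real.pi_pos]
    · simp [Real.pi_pos.le]
  have h := hasSum_intervalIntegral_of_norm_le (f := fun (m : ℤ × ℤ) (P₁ : ℝ) =>
      f m * (if m.2 - k.2 = 0 then 2 * Real.pi else 0) *
        Complex.exp (Complex.I * ((m.1 - k.1 : ℤ) * P₁))) (by fun_prop)
      (hf.mul_right (2 * Real.pi)) (fun m x => by rw [norm_mul, hexp, mul_one]; exact hb m)
      0 (2 * Real.pi)
  rw [← h.tsum_eq]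
  simp_rw [intervalIntegral.integral_const_mul, integral_exp_int]
  rw [tsum_eq_single k]
  · have := Complex.ofReal_ne_zero.2 Real.pi_ne_zero
    simp
    field_simp
  · intro m hm
    by_cases h2 : m.2 - k.2 = 0
    · have h1 : m.1 - k.1 ≠ 0 := fun h1 => hm (Prod.ext (sub_eq_zero.1 h1) (sub_eq_zero.1 h2))
      rw [if_neg h1, Complex.ofReal_zero, mul_zero]
    · rw [if_neg h2, Complex.ofReal_zero, mul_zero, zero_mul]

theorem eq_of_synth_chr_eq {f g : ℤ × ℤ → ℂ} (hf : RapidDecay f) (hg : RapidDecay g)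
    (h : ∀ p, synth (chr p) f = synth (chr p) g) : f = g := by
  funext k
  rw [← fourierCoeff_synth hf.summable_norm k, ← fourierCoeff_synth hg.summable_norm k]
  simp_rw [h]

theorem conj_synth_chr (f : ℤ × ℤ → ℂ) (p : ℝ × ℝ) :
    starRingEnd ℂ (synth (chr p) f) = synth (chr p) fun k => starRingEnd ℂ (f (-k)) := by
  rw [synth, synth, Complex.conj_tsum, ← (Equiv.neg (ℤ × ℤ)).tsum_eq]
  refine tsum_congr fun k => ?_
  rw [Equiv.neg_apply, smul_eq_mul, smul_eq_mul, map_mul, conj_chr, neg_neg]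

/-! ### Smoothness of Fourier series with rapidly decaying coefficients. -/

theorem iteratedDeriv_cexp_mul_ofReal (w : ℂ) (j : ℕ) (t : ℝ) :
    iteratedDeriv j (fun s : ℝ => Complex.exp (w * s)) t = w ^ j * Complex.exp (w * t) := by
  induction j generalizing t with
  | zero => simp
  | succ j ih =>
    rw [iteratedDeriv_succ, funext ih]
    have h1 : HasDerivAt (fun s : ℝ => Complex.exp (w * s)) (Complex.exp (w * t) * (w * 1)) t :=
      (((hasDerivAt_id (t : ℂ)).const_mul w).cexp).comp_ofReal
    rw [(h1.const_mul _).deriv]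
    ring

theorem contDiff_cexp_mul_ofReal (w : ℂ) :
    ContDiff ℝ ∞ fun s : ℝ => Complex.exp (w * s) :=
  (contDiff_const.mul Complex.ofRealCLM.contDiff).cexp

theorem norm_cexp_I_mul (t x : ℝ) : ‖Complex.exp (Complex.I * t * x)‖ = 1 := by
  have : Complex.I * t * x = ((t * x : ℝ) : ℂ) * Complex.I := by push_cast; ring
  rw [this, Complex.norm_exp_ofReal_mul_I]

/-- Each character is `e^{it}` composed with a linear form of norm at most `1 + len k`, so the
`j`-th derivative of a term costs the weight `(1 + len k) ^ j`. -/
theorem contDiff_synth_chr {f : ℤ × ℤ → ℂ} (hf : RapidDecay f) :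
    ContDiff ℝ ∞ fun p => synth (chr p) f := by
  let ℓ (k : ℤ × ℤ) : ℝ × ℝ →L[ℝ] ℝ :=
    (k.1 : ℝ) • ContinuousLinearMap.fst ℝ ℝ ℝ + (k.2 : ℝ) • ContinuousLinearMap.snd ℝ ℝ ℝ
  let E : ℝ → ℂ := fun t => Complex.exp (Complex.I * t)
  have hE : ContDiff ℝ ∞ E := contDiff_cexp_mul_ofReal _
  have hl : ∀ k, ‖ℓ k‖ ≤ 1 + len k := by
    intro k
    have h1 : |(k.1 : ℝ)| = (k.1.natAbs : ℝ) := by rw [Nat.cast_natAbs, Int.cast_abs]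
    have h2 : |(k.2 : ℝ)| = (k.2.natAbs : ℝ) := by rw [Nat.cast_natAbs, Int.cast_abs]
    refine (norm_add_le _ _).trans ?_
    rw [norm_smul, norm_smul, Real.norm_eq_abs, Real.norm_eq_abs, h1, h2, len, Nat.cast_add]
    have h3 : ‖ContinuousLinearMap.fst ℝ ℝ ℝ‖ ≤ 1 := ContinuousLinearMap.norm_fst_le ..
    have h4 : ‖ContinuousLinearMap.snd ℝ ℝ ℝ‖ ≤ 1 := ContinuousLinearMap.norm_snd_le ..
    nlinarith [mul_le_of_le_one_right (Nat.cast_nonneg (α := ℝ) k.1.natAbs) h3,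
      mul_le_of_le_one_right (Nat.cast_nonneg (α := ℝ) k.2.natAbs) h4]
  have hchr : ∀ k p, f k • chr p k = f k • (E ∘ ℓ k) p := by
    intro k p
    simp only [chr, E, ℓ, Function.comp]
    congr 3
    simp
    ring
  have hnE : ∀ t, ‖E t‖ = 1 := fun t => by
    simp only [E]
    rw [mul_comm, Complex.norm_exp_ofReal_mul_I]
  simp_rw [synth, hchr]
  refine contDiff_tsum (v := fun j k => (1 + len k : ℝ) ^ j * ‖f k‖)
    (fun k => (hE.comp (ℓ k).contDiff).const_smul _) (fun j _ => hf j) fun j k p hj => ?_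
  have hEj : ContDiff ℝ j E := hE.of_le (mod_cast le_top)
  change ‖iteratedFDeriv ℝ j (f k • (E ∘ ℓ k)) p‖ ≤ _
  rw [iteratedFDeriv_const_smul_apply (hEj.comp (ℓ k).contDiff).contDiffAt, norm_smul, mul_comm]
  gcongr
  rw [(ℓ k).iteratedFDeriv_comp_right hEj p le_rfl]
  refine (ContinuousMultilinearMap.norm_compContinuousLinearMap_le _ _).trans ?_
  rw [norm_iteratedFDeriv_eq_norm_iteratedDeriv, iteratedDeriv_cexp_mul_ofReal, norm_mul, norm_pow,
    Complex.norm_I, hnE, one_pow, one_mul, one_mul, Finset.prod_const, Finset.card_univ,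
    Fintype.card_fin]
  gcongr
  exact hl k

/-! ### The overlap coefficients -/

theorem I_zero (L : ℕ) : I L 0 = 1 := by simp [I]

theorem I_neg (L : ℕ) (m : ℤ × ℤ) : I L (-m) = I L m := by
  simp [I]

theorem conj_I (L : ℕ) (m : ℤ × ℤ) : starRingEnd ℂ (I L m) = I L m := by
  rw [I, map_mul, Complex.conj_ofReal, map_zpow₀, map_neg, map_one]

theorem exp_neg_pi_le : Real.exp (-Real.pi) ≤ 1 / 18 := by
  rw [Real.exp_neg, one_div]
  -- The constant 18 is twice 9, which leaves the ratio `1/9` after the weight `2 ^ len`; it is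
  -- available because `2.7 ^ 3 > 18`.
  refine inv_anti₀ (by norm_num) ?_
  calc (18 : ℝ) ≤ 2.7 ^ 3 := by norm_num
    _ ≤ Real.exp 1 ^ 3 := by
      gcongr
      exact (by norm_num : (2.7 : ℝ) ≤ 2.7182818283).trans Real.exp_one_gt_d9.le
    _ = Real.exp 3 := by rw [← Real.exp_nat_mul]; norm_num
    _ ≤ Real.exp Real.pi := Real.exp_le_exp.2 Real.pi_gt_three.le

/-- Integers satisfy `n² ≥ |n|`, and `L ≥ 2` turns the exponent `πL/2` into at least `π`. -/
theorem norm_I_le {L : ℕ} (hL : 1 < L) (m : ℤ × ℤ) : ‖I L m‖ ≤ (1 / 18) ^ len m := by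
  have h1 : ‖I L m‖ = Real.exp (-(Real.pi / 2) * L * ((m.1 : ℝ) ^ 2 + (m.2 : ℝ) ^ 2)) := by
    rw [I, norm_mul, norm_zpow, norm_neg, norm_one, one_zpow, one_mul, Complex.norm_real,
      Real.norm_of_nonneg (Real.exp_pos _).le]
  have h2 : ∀ n : ℤ, (n.natAbs : ℝ) ≤ (n : ℝ) ^ 2 := by
    intro n
    have h3 : |(n : ℝ)| = (n.natAbs : ℝ) := by rw [Nat.cast_natAbs, Int.cast_abs]
    rw [← sq_abs, h3]
    exact_mod_cast Nat.le_self_pow two_ne_zero _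
  calc ‖I L m‖ = Real.exp (-(Real.pi / 2) * L * ((m.1 : ℝ) ^ 2 + (m.2 : ℝ) ^ 2)) := h1
    _ ≤ Real.exp (len m * (-Real.pi)) := by
      refine Real.exp_le_exp.2 ?_
      have hL' : (2 : ℝ) ≤ L := mod_cast hL
      have h3 : (len m : ℝ) ≤ (m.1 : ℝ) ^ 2 + (m.2 : ℝ) ^ 2 := by
        rw [len, Nat.cast_add]
        exact add_le_add (h2 _) (h2 _)
      have h4 : (len m : ℝ) * Real.pi ≤ ((m.1 : ℝ) ^ 2 + (m.2 : ℝ) ^ 2) * Real.pi := by gcongr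
      have h5 : 0 ≤ ((m.1 : ℝ) ^ 2 + (m.2 : ℝ) ^ 2) * Real.pi := by positivity
      nlinarith [mul_le_mul_of_nonneg_right hL' h5]
    _ = Real.exp (-Real.pi) ^ len m := Real.exp_nat_mul _ _
    _ ≤ (1 / 18) ^ len m := by
      gcongr
      exact exp_neg_pi_le

theorem rapidDecay_I {L : ℕ} (hL : 1 < L) : RapidDecay (I L) :=
  RapidDecay.of_le_geometric (M := 1) (r := 1 / 18) (by norm_num) (by norm_num)
    fun k => by rw [one_mul]; exact norm_I_le hL k

/-- The overlap coefficients with the diagonal one removed. -/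
def offDiag (L : ℕ) (m : ℤ × ℤ) : ℂ := if m = 0 then 0 else I L m

/-! ### Smallness of the off-diagonal overlaps in the weighted norm. -/

theorem hasSum_geometric_natAbs :
    HasSum (fun n : ℤ => ((1 : ℝ) / 9) ^ n.natAbs) (5 / 4) := by
  have h := hasSum_geometric_of_lt_one (r := (1 : ℝ) / 9) (by norm_num) (by norm_num)
  have h' := h.mul_left (1 / 9)
  have := HasSum.of_nat_of_neg_add_one (f := fun n : ℤ => ((1 : ℝ) / 9) ^ n.natAbs)
    (m := (1 - 1 / 9)⁻¹) (m' := 1 / 9 * (1 - 1 / 9)⁻¹) (by simpa using h) (by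
      refine h'.congr_fun fun n => ?_
      rw [← pow_succ']
      congr 1)
  norm_num at this ⊢
  exact this

theorem hasSum_geometric_len : HasSum (fun k : ℤ × ℤ => ((1 : ℝ) / 9) ^ len k) (25 / 16) := by
  have h := hasSum_geometric_natAbs
  have h2 := h.mul h (h.summable.mul_of_nonneg h.summable (fun _ => by positivity)
    fun _ => by positivity)
  rw [show (25 / 16 : ℝ) = 5 / 4 * (5 / 4) by norm_num]
  exact h2.congr_fun fun k => pow_add _ _ _

theorem two_pow_mul_norm_offDiag_le {L : ℕ} (hL : 1 < L) (k : ℤ × ℤ) :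
    2 ^ len k * ‖offDiag L k‖ ≤ if k = 0 then 0 else ((1 : ℝ) / 9) ^ len k := by
  rw [offDiag]
  split_ifs
  · simp
  · calc (2 : ℝ) ^ len k * ‖I L k‖ ≤ 2 ^ len k * (1 / 18) ^ len k := by
          gcongr; exact norm_I_le hL k
      _ = (1 / 9) ^ len k := by rw [← mul_pow]; norm_num

/-- The bound `ρ < 1` drives everything about `F^{-1/2}`: it yields both positivity of `F` and
convergence of the binomial series. -/
theorem exists_hasSum_offDiag {L : ℕ} (hL : 1 < L) :
    ∃ ρ < 1, HasSum (fun k => 2 ^ len k * ‖offDiag L k‖) ρ := by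
  have h := hasSum_geometric_len.update 0 0
  have hle : ∀ k, 2 ^ len k * ‖offDiag L k‖ ≤
      Function.update (fun k : ℤ × ℤ => ((1 : ℝ) / 9) ^ len k) 0 0 k := fun k => by
    rw [Function.update_apply]
    exact two_pow_mul_norm_offDiag_le hL k
  have hs := Summable.of_nonneg_of_le (fun _ => by positivity) hle h.summable
  refine ⟨_, (hasSum_le hle hs.hasSum h).trans_lt ?_, hs.hasSum⟩
  -- Removing the term at 0 from the sum `25/16` leaves `9/16`.
  norm_num [len]

theorem rapidDecay_offDiag {L : ℕ} (hL : 1 < L) : RapidDecay (offDiag L) :=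
  (rapidDecay_I hL).of_norm_le_mul (M := 1) fun k => by
    rw [offDiag]
    split_ifs
    · rw [norm_zero]; positivity
    · nlinarith [mul_nonneg (Nat.cast_nonneg (α := ℝ) (len k)) (norm_nonneg (I L k))]

theorem F_eq_synth (L : ℕ) (p : ℝ × ℝ) : F L p = synth (chr p) (I L) := rfl

theorem F_eq_one_add {L : ℕ} (hL : 1 < L) (p : ℝ × ℝ) :
    F L p = 1 + synth (chr p) (offDiag L) := by
  have h := (hasSum_synth (norm_chr_le p) (rapidDecay_I hL).summable_norm).summable
  rw [F_eq_synth, synth, h.tsum_eq_add_tsum_ite 0, I_zero, chr_zero, one_smul, synth]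
  congr 1
  refine tsum_congr fun k => ?_
  rw [offDiag]
  split_ifs <;> simp

theorem norm_synth_offDiag_le {L : ℕ} {ρ : ℝ}
    (hρ : HasSum (fun k => 2 ^ len k * ‖offDiag L k‖) ρ) (p : ℝ × ℝ) :
    ‖synth (chr p) (offDiag L)‖ ≤ ρ := by
  refine tsum_of_norm_bounded hρ fun k => ?_
  rw [norm_smul, norm_chr, mul_one]
  exact le_mul_of_one_le_left (norm_nonneg _) (one_le_pow₀ one_le_two)

/-- The coefficients `I` are real and even. -/
theorem F_im (L : ℕ) (p : ℝ × ℝ) : (F L p).im = 0 := by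
  rw [← Complex.conj_eq_iff_im, F_eq_synth, conj_synth_chr]
  congr 1
  funext k
  rw [conj_I, I_neg]

theorem F_re_pos {L : ℕ} (hL : 1 < L) (p : ℝ × ℝ) : 0 < (F L p).re := by
  obtain ⟨ρ, h1, hρ⟩ := exists_hasSum_offDiag hL
  have h2 := (Complex.abs_re_le_norm _).trans (norm_synth_offDiag_le hρ p)
  rw [F_eq_one_add hL, Complex.add_re, Complex.one_re]
  linarith [(abs_le.1 h2).1]

theorem contDiff_C {L : ℕ} (hL : 1 < L) : ContDiff ℝ ∞ (C L) := by
  have h : ContDiff ℝ ∞ fun p => (F L p).re :=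
    Complex.reCLM.contDiff.comp (contDiff_synth_chr (rapidDecay_I hL))
  exact contDiff_const.div (h.sqrt fun p => (F_re_pos hL p).ne')
    fun p => (Real.sqrt_pos.2 (F_re_pos hL p)).ne'

/-! ### The binomial series and the Fourier coefficients of `F^{-1/2}`. -/

/-- The Taylor coefficients of `t ↦ (1 + t)^{-1/2}`. -/
def invSqrtCoeff (j : ℕ) : ℂ := ((Ring.choose (-(1 / 2) : ℝ) j : ℝ) : ℂ)

theorem summable_invSqrtCoeff {ρ : ℝ} (h0 : 0 ≤ ρ) (h1 : ρ < 1) :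
    Summable fun j => ‖invSqrtCoeff j‖ * ρ ^ j := by
  lift ρ to NNReal using h0
  have hr : (ρ : ℝ≥0∞) < (binomialSeries ℝ (-(1 / 2) : ℝ)).radius :=
    lt_of_lt_of_le (mod_cast h1) Real.one_add_rpow_hasFPowerSeriesOnBall_zero.r_le
  refine (FormalMultilinearSeries.summable_norm_mul_pow _ hr).congr fun j => ?_
  rw [binomialSeries, FormalMultilinearSeries.ofScalars_norm, invSqrtCoeff, Complex.norm_real]

theorem tsum_invSqrtCoeff {t : ℝ} (ht : |t| < 1) :
    ∑' j, invSqrtCoeff j • (t : ℂ) ^ j = ((1 / Real.sqrt (1 + t) : ℝ) : ℂ) := by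
  have h := (Real.one_add_rpow_hasFPowerSeriesOnBall_zero (a := -(1 / 2))).hasSum (y := t)
    (by simpa [enorm_eq_nnnorm, ← NNReal.coe_lt_coe] using! ht)
  have h2 : (1 + (0 + t)) ^ (-(1 / 2) : ℝ) = 1 / Real.sqrt (1 + t) := by
    rw [zero_add, Real.rpow_neg (by linarith [(abs_lt.1 ht).1]), ← Real.sqrt_eq_rpow, one_div]
  rw [h2] at h
  rw [← h.tsum_eq, Complex.ofReal_tsum]
  refine tsum_congr fun j => ?_
  rw [binomialSeries_apply, List.ofFn_const, List.prod_replicate, invSqrtCoeff,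
    smul_eq_mul, smul_eq_mul, Complex.ofReal_mul, Complex.ofReal_pow]

/-- The binomial series is formed first at the level of coefficients, where geometric decay is
visible. It synthesizes to `C`, so its coefficients are the Fourier integrals defining `c`. No
Fourier inversion for smooth functions is needed. -/
theorem rapidDecay_c_and_synth_chr_c {L : ℕ} (hL : 1 < L) :
    RapidDecay (c L) ∧ ∀ p, synth (chr p) (c L) = C L p := by
  obtain ⟨ρ, h1, hρ⟩ := exists_hasSum_offDiag hL
  have h0 : 0 ≤ ρ := hρ.nonneg fun _ => by positivity
  have ha := summable_invSqrtCoeff h0 h1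
  have hd : RapidDecay (convSeries invSqrtCoeff (offDiag L)) :=
    RapidDecay.of_le_geometric (by norm_num) (by norm_num) (norm_convSeries_le hρ ha.hasSum)
  have hs : ∀ p, synth (chr p) (convSeries invSqrtCoeff (offDiag L)) = C L p := by
    intro p
    rw [synth_convSeries (norm_chr_le p) (chr_add p) (chr_zero p) hρ (rapidDecay_offDiag hL) ha]
    have hF := F_eq_one_add hL p
    have hre : synth (chr p) (offDiag L) = (((F L p).re - 1 : ℝ) : ℂ) := by
      rw [← Complex.re_add_im (F L p), F_im, Complex.ofReal_zero, zero_mul] at hF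
      push_cast
      linear_combination -hF
    have ht : |(F L p).re - 1| < 1 := by
      have := norm_synth_offDiag_le hρ p
      rw [hre, Complex.norm_real] at this
      exact this.trans_lt h1
    rw [hre, tsum_invSqrtCoeff ht, add_sub_cancel, C]
  have hc : c L = convSeries invSqrtCoeff (offDiag L) := by
    funext k
    rw [← fourierCoeff_synth hd.summable_norm k, c]
    simp_rw [hs]
  rw [hc]
  exact ⟨hd, hs⟩

theorem rapidDecay_c {L : ℕ} (hL : 1 < L) : RapidDecay (c L) := (rapidDecay_c_and_synth_chr_c hL).1

theorem synth_chr_c {L : ℕ} (hL : 1 < L) (p : ℝ × ℝ) : synth (chr p) (c L) = C L p :=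
  (rapidDecay_c_and_synth_chr_c hL).2 p

/-- This reflects that `C` is real-valued; it becomes self-adjointness of `X`. -/
theorem conj_c_neg {L : ℕ} (hL : 1 < L) (k : ℤ × ℤ) : starRingEnd ℂ (c L (-k)) = c L k := by
  have hd : RapidDecay fun k => starRingEnd ℂ (c L (-k)) := fun N =>
    ((Equiv.neg (ℤ × ℤ)).summable_iff.2 (rapidDecay_c hL N)).congr fun k => by
      simp [len_neg]
  refine congrFun (eq_of_synth_chr_eq hd (rapidDecay_c hL) fun p => ?_) k
  rw [← conj_synth_chr, synth_chr_c hL, Complex.conj_ofReal]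

/-- The coefficient form of `F^{-1/2} F^{-1/2} F = 1`. Invertibility of `X` and orthonormality of
`Ψ` both come from it. -/
theorem conv_conv_c_c_I {L : ℕ} (hL : 1 < L) : conv (conv (c L) (c L)) (I L) = Pi.single 0 1 := by
  have hc := rapidDecay_c hL
  have hI := rapidDecay_I hL
  refine eq_of_synth_chr_eq ((hc.conv hc).conv hI) ?_ fun p => ?_
  · refine RapidDecay.of_le_geometric (M := 1) (r := 0) le_rfl one_pos fun k => ?_
    by_cases hk : k = 0
    · subst hk; simp [len]
    · simp only [Pi.single_apply, hk, if_false, norm_zero]; positivity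
  · rw [synth_single, chr_zero, synth_conv (norm_chr_le p) (chr_add p) (hc.conv hc) hI,
      synth_conv (norm_chr_le p) (chr_add p) hc hc, synth_chr_c hL, ← F_eq_synth,
      ← Complex.re_add_im (F L p), F_im, C]
    have h := F_re_pos hL p
    have h2 := Real.mul_self_sqrt h.le
    have h3 := (Real.sqrt_pos.2 h).ne'
    have : 1 / Real.sqrt (F L p).re * (1 / Real.sqrt (F L p).re) * (F L p).re = 1 := by
      field_simp
      rw [sq, h2]
    rw [Complex.ofReal_zero, zero_mul, add_zero]
    exact_mod_cast this

/-! ### The lattice of translations and modulations -/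

theorem coeFn_expQ (t : ℝ) (f : H) :
    expQ t f =ᵐ[volume] fun x : ℝ => Complex.exp (Complex.I * t * x) * f x :=
  coeFn_modulationFun t f

theorem coeFn_expNegP (t : ℝ) (f : H) :
    expNegP t f =ᵐ[volume] fun x : ℝ => f (x - t) :=
  Lp.coeFn_compMeasurePreserving f (measurePreserving_sub_right volume t)

theorem ae_sub_of_ae {p : ℝ → Prop} (t : ℝ) (h : ∀ᵐ x, p x) : ∀ᵐ x : ℝ, p (x - t) :=
  (measurePreserving_sub_right volume t).quasiMeasurePreserving.ae h

theorem isometry_mul_apply (U V : H ≃ₗᵢ[ℂ] H) (f : H) : (U * V) f = U (V f) := rfl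

theorem expQ_add (s t : ℝ) : expQ (s + t) = expQ s * expQ t := by
  ext1 f
  refine Lp.ext ?_
  filter_upwards [coeFn_expQ (s + t) f, coeFn_expQ s (expQ t f), coeFn_expQ t f] with x h1 h2 h3
  rw [isometry_mul_apply, h1, h2, h3, ← mul_assoc, ← Complex.exp_add]
  congr 2
  push_cast
  ring

theorem expNegP_add (s t : ℝ) : expNegP (s + t) = expNegP s * expNegP t := by
  ext1 f
  refine Lp.ext ?_
  filter_upwards [coeFn_expNegP (s + t) f, coeFn_expNegP s (expNegP t f),
    ae_sub_of_ae s (coeFn_expNegP t f)] with x h1 h2 h3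
  rw [isometry_mul_apply, h1, h2, h3, sub_sub]

theorem zpow_eq_of_map_add {G : Type*} [Group G] {U : ℝ → G} (h : ∀ s t, U (s + t) = U s * U t)
    (t : ℝ) (n : ℤ) : U t ^ n = U (n * t) := by
  have h0 : U 0 = 1 := by simpa using h 0 0
  let f : Multiplicative ℝ →* G := ⟨⟨fun s => U s.toAdd, h0⟩, fun s t => h _ _⟩
  have := (map_zpow f (Multiplicative.ofAdd t) n).symm
  rw [← ofAdd_zsmul] at this
  simpa [f] using this

/-- The two orders differ by the phase `e^{ia²} = e^{2πiL} = 1`. -/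
theorem commute_T {L : ℕ} {a : ℝ} (ha : a ^ 2 = 2 * Real.pi * L) : Commute (T₁ a) (T₂ a) := by
  ext1 f
  refine Lp.ext ?_
  simp only [isometry_mul_apply, T₁, T₂]
  filter_upwards [coeFn_expQ a (expNegP a f), coeFn_expNegP a f, coeFn_expNegP a (expQ a f),
    ae_sub_of_ae a (coeFn_expQ a f)] with x h1 h2 h3 h4
  rw [h1, h2, h3, h4]
  have h5 : Complex.I * a * x =
      Complex.I * a * ((x - a : ℝ) : ℂ) + (L : ℤ) * (2 * Real.pi * Complex.I) := by
    have : (a : ℂ) ^ 2 = 2 * Real.pi * L := mod_cast congrArg Complex.ofReal ha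
    push_cast
    linear_combination Complex.I * this
  rw [h5, Complex.exp_add, Complex.exp_int_mul_two_pi_mul_I, mul_one]

theorem latticeOp_apply (a : ℝ) (k : ℤ × ℤ) (f : H) :
    latticeOp a k f = (T₁ a ^ k.1 * T₂ a ^ k.2) f := rfl

theorem latticeOp_eq (a : ℝ) (k : ℤ × ℤ) (f : H) :
    latticeOp a k f = expQ (k.1 * a) (expNegP (k.2 * a) f) := by
  rw [latticeOp_apply, isometry_mul_apply, T₁, T₂, zpow_eq_of_map_add expQ_add,
    zpow_eq_of_map_add expNegP_add]

theorem coeFn_latticeOp (a : ℝ) (k : ℤ × ℤ) (f : H) :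
    latticeOp a k f =ᵐ[volume]
      fun x : ℝ => Complex.exp (Complex.I * ((k.1 * a : ℝ) : ℂ) * x) * f (x - k.2 * a) := by
  rw [latticeOp_eq]
  filter_upwards [coeFn_expQ (k.1 * a) (expNegP (k.2 * a) f), coeFn_expNegP (k.2 * a) f]
    with x h1 h2
  rw [h1, h2]

theorem norm_latticeOp_apply (a : ℝ) (k : ℤ × ℤ) (f : H) : ‖latticeOp a k f‖ = ‖f‖ :=
  LinearIsometryEquiv.norm_map _ f

theorem norm_latticeOp_le (a : ℝ) (k : ℤ × ℤ) : ‖latticeOp a k‖ ≤ 1 :=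
  ContinuousLinearMap.opNorm_le_bound _ zero_le_one fun f => by
    rw [norm_latticeOp_apply, one_mul]

theorem latticeOp_zero (a : ℝ) : latticeOp a 0 = 1 := by
  ext1 f
  rw [latticeOp_apply]
  simp

section Lattice

variable {L : ℕ} {a : ℝ} (ha : a ^ 2 = 2 * Real.pi * L)

include ha

theorem latticeOp_add (k l : ℤ × ℤ) : latticeOp a (k + l) = latticeOp a k * latticeOp a l := by
  ext1 f
  rw [mul_apply_eq_comp, latticeOp_apply, latticeOp_apply, latticeOp_apply,
    ← isometry_mul_apply, Prod.fst_add, Prod.snd_add, zpow_add, zpow_add]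
  have h := (((commute_T ha).zpow_left l.1).zpow_right k.2).eq
  congr 1
  rw [mul_assoc, mul_assoc, ← mul_assoc (T₁ a ^ l.1), h, mul_assoc]

theorem latticeOp_add_apply (k l : ℤ × ℤ) (f : H) :
    latticeOp a (k + l) f = latticeOp a k (latticeOp a l f) := by
  rw [latticeOp_add ha]; rfl

theorem inner_latticeOp_left (k : ℤ × ℤ) (f g : H) :
    ⟪latticeOp a k f, g⟫_ℂ = ⟪f, latticeOp a (-k) g⟫_ℂ := by
  have h : g = latticeOp a k (latticeOp a (-k) g) := by
    rw [← latticeOp_add_apply ha, add_neg_cancel, latticeOp_zero]; rfl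
  conv_lhs => rw [h]
  exact LinearIsometryEquiv.inner_map_map _ _ _

theorem star_latticeOp (k : ℤ × ℤ) : star (latticeOp a k) = latticeOp a (-k) := by
  refine ContinuousLinearMap.ext fun f => ext_inner_left ℂ fun g => ?_
  rw [ContinuousLinearMap.star_eq_adjoint, ContinuousLinearMap.adjoint_inner_right,
    inner_latticeOp_left ha]

theorem star_synth_latticeOp (f : ℤ × ℤ → ℂ) :
    star (synth (latticeOp a) f) = synth (latticeOp a) fun k => starRingEnd ℂ (f (-k)) := by
  rw [synth, synth, tsum_star, ← (Equiv.neg (ℤ × ℤ)).tsum_eq]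
  refine tsum_congr fun k => ?_
  rw [Equiv.neg_apply, star_smul, star_latticeOp ha, neg_neg]
  rfl

theorem synth_latticeOp_conv {f g : ℤ × ℤ → ℂ} (hf : RapidDecay f) (hg : RapidDecay g) :
    synth (latticeOp a) (conv f g) = synth (latticeOp a) f * synth (latticeOp a) g :=
  synth_conv (norm_latticeOp_le a) (latticeOp_add ha) hf hg

theorem latticeOp_φ (k n : ℤ × ℤ) : latticeOp a k (φ a n) = φ a (k + n) :=
  (latticeOp_add_apply ha k n vacuum).symm

omit ha in
theorem hasSum_synth_latticeOp (a : ℝ) {f : ℤ × ℤ → ℂ} (hf : Summable fun k => ‖f k‖) (v : H) :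
    HasSum (fun k => f k • latticeOp a k v) (synth (latticeOp a) f v) :=
  (hasSum_synth (norm_latticeOp_le a) hf).mapL (ContinuousLinearMap.apply ℂ H v)

theorem latticeOp_synth_apply {f : ℤ × ℤ → ℂ} (hf : Summable fun k => ‖f k‖) (n : ℤ × ℤ) (v : H) :
    latticeOp a n (synth (latticeOp a) f v) = synth (latticeOp a) f (latticeOp a n v) := by
  refine ((hasSum_synth_latticeOp a hf v).mapL (latticeOp a n)).unique ?_
  refine (hasSum_synth_latticeOp a hf (latticeOp a n v)).congr_fun fun k => ?_
  rw [map_smul, ← latticeOp_add_apply ha, ← latticeOp_add_apply ha, add_comm]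

end Lattice

/-! ### The operator `X_L` -/

theorem X_eq_synth (a : ℝ) (L : ℕ) : X a L = synth (latticeOp a) (c L) := rfl

section OperatorX

variable {L : ℕ} (hL : 1 < L) {a : ℝ} (ha : a ^ 2 = 2 * Real.pi * L)

include hL ha

theorem isSelfAdjoint_X : IsSelfAdjoint (X a L) := by
  rw [isSelfAdjoint_iff, X_eq_synth, star_synth_latticeOp ha]
  congr 1
  exact funext (conj_c_neg hL)

theorem inner_X_left (f g : H) : ⟪X a L f, g⟫_ℂ = ⟪f, X a L g⟫_ℂ := by
  conv_rhs => rw [← (isSelfAdjoint_X hL ha).star_eq]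
  exact (ContinuousLinearMap.adjoint_inner_right _ _ _).symm

theorem X_mul_X_mul : X a L * X a L * synth (latticeOp a) (I L) = 1 := by
  have hc := rapidDecay_c hL
  rw [X_eq_synth, ← synth_latticeOp_conv ha hc hc,
    ← synth_latticeOp_conv ha (hc.conv hc) (rapidDecay_I hL), conv_conv_c_c_I hL, synth_single,
    latticeOp_zero]

/-- `X_mul_X_mul` supplies a right inverse of `X`; its adjoint supplies a left inverse, since both
`X` and the operator with coefficients `I` are self-adjoint. -/
theorem isUnit_X : IsUnit (X a L) := by
  have h := X_mul_X_mul hL ha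
  have h' := congrArg star h
  have hS : star (synth (latticeOp a) (I L)) = synth (latticeOp a) (I L) := by
    rw [star_synth_latticeOp ha]
    congr 1
    funext k
    rw [conj_I, I_neg]
  rw [star_mul, star_mul, (isSelfAdjoint_X hL ha).star_eq, hS, star_one] at h'
  rw [mul_assoc] at h
  rw [← mul_assoc] at h'
  exact isUnit_iff_exists.2 ⟨_, h, left_inv_eq_right_inv h' h ▸ h'⟩

theorem inverse_X : Ring.inverse (X a L) = synth (latticeOp a) (conv (c L) (I L)) := by
  have h := X_mul_X_mul hL ha
  rw [mul_assoc, X_eq_synth, ← synth_latticeOp_conv ha (rapidDecay_c hL) (rapidDecay_I hL),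
    ← X_eq_synth] at h
  rw [← mul_one (Ring.inverse (X a L)), ← h, ← mul_assoc,
    Ring.inverse_mul_cancel _ (isUnit_X hL ha), one_mul]

theorem X_inverse_apply (f : H) : X a L (Ring.inverse (X a L) f) = f :=
  congrArg (fun T : H →L[ℂ] H => T f) (Ring.mul_inverse_cancel _ (isUnit_X hL ha))

theorem inverse_X_apply (f : H) : Ring.inverse (X a L) (X a L f) = f :=
  congrArg (fun T : H →L[ℂ] H => T f) (Ring.inverse_mul_cancel _ (isUnit_X hL ha))

theorem inner_inverse_X_left (f g : H) :
    ⟪Ring.inverse (X a L) f, g⟫_ℂ = ⟪f, Ring.inverse (X a L) g⟫_ℂ := by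
  conv_lhs => rw [← X_inverse_apply hL ha g]
  rw [← inner_X_left hL ha, X_inverse_apply hL ha]

end OperatorX

/-! ### Overlaps of the coherent states -/

theorem coeFn_vacuum : vacuum =ᵐ[volume]
    fun x : ℝ => ((Real.pi ^ (-(1 / 4) : ℝ) * Real.exp (-x ^ 2 / 2) : ℝ) : ℂ) :=
  MemLp.coeFn_toLp _

theorem φ_zero (a : ℝ) : φ a 0 = vacuum := by
  rw [φ, latticeOp_zero]; rfl

/-- A Gaussian integral with complex linear term: completing the square gives the Gaussian factor
and a cross term `-i m₁ m₂ a²/2`. -/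
theorem inner_φ_φ_zero {L : ℕ} {a : ℝ} (ha : a ^ 2 = 2 * Real.pi * L) (m : ℤ × ℤ) :
    ⟪φ a m, φ a 0⟫_ℂ = I L m := by
  have hint : ⟪φ a m, φ a 0⟫_ℂ = ∫ x : ℝ, ((Real.pi ^ (-(1 / 2) : ℝ) : ℝ) : ℂ) *
      Complex.exp ((-1 : ℂ) * (x : ℂ) ^ 2 + (m.2 * a - Complex.I * (m.1 * a)) * x +
        -(m.2 * a) ^ 2 / 2) := by
    rw [L2.inner_def, φ_zero]
    refine integral_congr_ae ?_
    filter_upwards [coeFn_latticeOp a m vacuum, coeFn_vacuum,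
      ae_sub_of_ae (m.2 * a) coeFn_vacuum] with x h1 h2 h3
    have hpi : Real.pi ^ (-(1 / 2) : ℝ) = Real.pi ^ (-(1 / 4) : ℝ) * Real.pi ^ (-(1 / 4) : ℝ) := by
      rw [← Real.rpow_add Real.pi_pos]; norm_num
    rw [φ, h1, h2, h3, RCLike.inner_apply, map_mul, Complex.conj_ofReal, ← Complex.exp_conj, hpi]
    push_cast
    have e : Complex.exp ((-1 : ℂ) * (x : ℂ) ^ 2 + (m.2 * a - Complex.I * (m.1 * a)) * x +
        -(m.2 * a) ^ 2 / 2) = Complex.exp (-(x : ℂ) ^ 2 / 2) *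
        (Complex.exp (starRingEnd ℂ (Complex.I * (m.1 * a) * x)) *
          Complex.exp (-((x : ℂ) - m.2 * a) ^ 2 / 2)) := by
      rw [← Complex.exp_add, ← Complex.exp_add]
      congr 1
      simp only [map_mul, Complex.conj_I, Complex.conj_ofReal, map_intCast]
      ring
    rw [e]
    ring
  have hπ : (Real.pi : ℂ) ^ (1 / 2 : ℂ) = ((Real.pi ^ (1 / 2 : ℝ) : ℝ) : ℂ) := by
    rw [Complex.ofReal_cpow Real.pi_pos.le]; norm_num
  rw [hint, integral_const_mul, integral_cexp_quadratic (by norm_num), neg_neg, div_one, hπ,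
    ← mul_assoc, ← Complex.ofReal_mul, ← Real.rpow_add Real.pi_pos, neg_add_cancel, Real.rpow_zero,
    Complex.ofReal_one, one_mul, I]
  -- The cross term equals `-iπ L m₁ m₂`, so the sign is written with `-πi` to match.
  have hs : ((-1 : ℂ)) ^ ((L : ℤ) * m.1 * m.2) =
      Complex.exp (((L : ℤ) * m.1 * m.2 : ℤ) * -(Real.pi * Complex.I)) := by
    rw [Complex.exp_int_mul, Complex.exp_neg, Complex.exp_pi_mul_I]
    norm_num
  rw [hs, Complex.ofReal_exp, ← Complex.exp_add]
  congr 1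
  have : (a : ℂ) ^ 2 = 2 * Real.pi * L := mod_cast congrArg Complex.ofReal ha
  push_cast
  linear_combination (-(m.2 : ℂ) ^ 2 / 4 + (Complex.I) ^ 2 * (m.1 : ℂ) ^ 2 / 4
    - Complex.I * m.1 * m.2 / 2) * this + Real.pi * L * (m.1 : ℂ) ^ 2 / 2 * Complex.I_sq

/-! ### The orthonormal system -/

section System

variable {L : ℕ} {a : ℝ} (ha : a ^ 2 = 2 * Real.pi * L)

include ha

theorem inner_φ (m n : ℤ × ℤ) : ⟪φ a m, φ a n⟫_ℂ = I L (m - n) := by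
  rw [← inner_φ_φ_zero ha, sub_eq_neg_add, ← latticeOp_φ ha (-n), inner_latticeOp_left ha, neg_neg,
    latticeOp_φ ha, add_zero]

/-- Lattice operators permute the `φ a n`, hence preserve their closed span, which also contains
limits of finite combinations. -/
theorem synth_latticeOp_mem_hL {f : ℤ × ℤ → ℂ} (hf : Summable fun k => ‖f k‖) {v : H}
    (hv : v ∈ hL a) : synth (latticeOp a) f v ∈ hL a := by
  have hk : ∀ k, latticeOp a k v ∈ hL a := by
    intro k
    have : hL a ≤ (hL a).comap (latticeOp a k : H →ₗ[ℂ] H) := by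
      refine Submodule.topologicalClosure_minimal _ (Submodule.span_le.2 ?_) ?_
      · rintro _ ⟨n, rfl⟩
        refine Submodule.le_topologicalClosure _ (Submodule.subset_span ⟨k + n, ?_⟩)
        exact (latticeOp_φ ha k n).symm
      · exact (Submodule.isClosed_topologicalClosure _).preimage (latticeOp a k).continuous
    exact this hv
  exact (Submodule.isClosed_topologicalClosure _).mem_of_tendsto (hasSum_synth_latticeOp a hf v)
    (Eventually.of_forall fun s => Submodule.sum_mem _ fun k _ => Submodule.smul_mem _ _ (hk k))

omit ha in
theorem φ_mem_hL (a : ℝ) (n : ℤ × ℤ) : φ a n ∈ hL a :=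
  Submodule.le_topologicalClosure _ (Submodule.subset_span ⟨n, rfl⟩)

variable (hL : 1 < L)

include hL

theorem latticeOp_Ψ (k n : ℤ × ℤ) : latticeOp a k (Ψ a L n) = Ψ a L (k + n) := by
  rw [Ψ, X_eq_synth, latticeOp_synth_apply ha (rapidDecay_c hL).summable_norm, latticeOp_φ ha]
  rfl

theorem X_mem_hL {f : H} (hf : f ∈ CoherentON.hL a) : X a L f ∈ CoherentON.hL a :=
  synth_latticeOp_mem_hL ha (rapidDecay_c hL).summable_norm hf

theorem inverse_X_mem_hL {f : H} (hf : f ∈ CoherentON.hL a) :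
    Ring.inverse (X a L) f ∈ CoherentON.hL a := by
  rw [inverse_X hL ha]
  exact synth_latticeOp_mem_hL ha ((rapidDecay_c hL).conv (rapidDecay_I hL)).summable_norm hf

theorem hasSum_Ψ (n : ℤ × ℤ) : HasSum (fun k => c L k • φ a (k + n)) (Ψ a L n) :=
  (hasSum_synth_latticeOp a (rapidDecay_c hL).summable_norm (φ a n)).congr_fun fun k => by
    rw [latticeOp_φ ha]

/-- Moving one `X` across gives `⟨φ_i, X² φ_j⟩`; expanding `X²` with coefficients `c * c` and using
the overlaps produces `(c * c * I)(i - j)`. -/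
theorem orthonormal_Ψ : Orthonormal ℂ (Ψ a L) := by
  rw [orthonormal_iff_ite]
  intro i j
  have hc := rapidDecay_c hL
  have hX : X a L (Ψ a L j) = synth (latticeOp a) (conv (c L) (c L)) (φ a j) := by
    rw [synth_latticeOp_conv ha hc hc]; rfl
  have h1 : ⟪Ψ a L i, Ψ a L j⟫_ℂ = conv (conv (c L) (c L)) (I L) (i - j) := by
    rw [Ψ, inner_X_left hL ha, hX]
    refine ((hasSum_synth_latticeOp a (hc.conv hc).summable_norm (φ a j)).mapL
      (innerSL ℂ (φ a i))).tsum_eq.symm.trans (tsum_congr fun k => ?_)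
    rw [map_smul, innerSL_apply_apply, latticeOp_φ ha, inner_φ ha, smul_eq_mul, sub_sub, add_comm j]
  rw [h1, conv_conv_c_c_I hL, Pi.single_apply]
  simp only [sub_eq_zero]

theorem span_Ψ_topologicalClosure :
    (Submodule.span ℂ (Set.range (Ψ a L))).topologicalClosure = CoherentON.hL a := by
  refine le_antisymm ?_ ?_
  · refine Submodule.topologicalClosure_minimal _ (Submodule.span_le.2 ?_)
      (Submodule.isClosed_topologicalClosure _)
    rintro _ ⟨n, rfl⟩
    exact X_mem_hL ha hL (φ_mem_hL a n)
  · refine Submodule.topologicalClosure_minimal _ (Submodule.span_le.2 ?_)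
      (Submodule.isClosed_topologicalClosure _)
    rintro _ ⟨n, rfl⟩
    -- The series for `X⁻¹` applied to `Ψ a L n` sums to `φ a n`, and its terms are multiples of
    -- translates `Ψ a L (k + n)`.
    have h := hasSum_synth_latticeOp a ((rapidDecay_c hL).conv (rapidDecay_I hL)).summable_norm
      (Ψ a L n)
    rw [← inverse_X hL ha, Ψ, inverse_X_apply hL ha, ← Ψ] at h
    refine (Submodule.isClosed_topologicalClosure _).mem_of_tendsto h
      (Eventually.of_forall fun s => Submodule.sum_mem _ fun k _ => Submodule.smul_mem _ _ ?_)
    rw [latticeOp_Ψ ha hL]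
    exact Submodule.le_topologicalClosure _ (Submodule.subset_span ⟨_, rfl⟩)

end System

/-! ### Pairing with Schwartz functions -/

theorem hasTemperateGrowth_cexp_I_mul (t : ℝ) :
    Function.HasTemperateGrowth fun x : ℝ => Complex.exp (Complex.I * t * x) := by
  refine ⟨contDiff_cexp_mul_ofReal _, fun n => ⟨0, |t| ^ n, fun x => ?_⟩⟩
  rw [norm_iteratedFDeriv_eq_norm_iteratedDeriv, iteratedDeriv_cexp_mul_ofReal, norm_mul, norm_pow,
    norm_cexp_I_mul, norm_mul, Complex.norm_I, Complex.norm_real, one_mul, pow_zero]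
  rfl

/-- Multiplication by `x` on Schwartz functions. -/
def xMul (η : 𝓢(ℝ, ℂ)) : 𝓢(ℝ, ℂ) := SchwartzMap.smulLeftCLM ℂ (fun x : ℝ => (x : ℂ)) η

theorem xMul_apply (η : 𝓢(ℝ, ℂ)) (x : ℝ) : xMul η x = x * η x :=
  SchwartzMap.smulLeftCLM_apply_apply Function.Complex.hasTemperateGrowth_ofReal η x

/-- Multiplication by `x ↦ e^{itx}` followed by a translation on Schwartz functions. -/
def weyl (t s : ℝ) (η : 𝓢(ℝ, ℂ)) : 𝓢(ℝ, ℂ) :=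
  SchwartzMap.compSubConstCLM ℂ (-s)
    (SchwartzMap.smulLeftCLM ℂ (fun x : ℝ => Complex.exp (Complex.I * t * x)) η)

theorem weyl_apply (t s : ℝ) (η : 𝓢(ℝ, ℂ)) (x : ℝ) :
    weyl t s η x = Complex.exp (Complex.I * t * (x + s : ℝ)) * η (x + s) := by
  rw [weyl, SchwartzMap.compSubConstCLM_apply,
    SchwartzMap.smulLeftCLM_apply_apply (hasTemperateGrowth_cexp_I_mul t), sub_neg_eq_add,
    smul_eq_mul]

theorem deriv_weyl (t s : ℝ) (η : 𝓢(ℝ, ℂ)) (x : ℝ) :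
    deriv (weyl t s η) x = Complex.I * t * weyl t s η x +
      Complex.exp (Complex.I * t * (x + s : ℝ)) * deriv η (x + s) := by
  have h1 : HasDerivAt (fun y : ℝ => Complex.exp (Complex.I * t * y))
      (Complex.exp (Complex.I * t * (x + s : ℝ)) * (Complex.I * t * 1)) (x + s) :=
    (((hasDerivAt_id ((x + s : ℝ) : ℂ)).const_mul (Complex.I * t)).cexp).comp_ofReal
  have h2 : HasDerivAt (fun y : ℝ => Complex.exp (Complex.I * t * y) * η y) _ (x + s) :=
    h1.mul (η.differentiableAt.hasDerivAt)
  have h3 := HasDerivAt.comp_add_const x s h2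
  have h4 : ⇑(weyl t s η) =
      fun y : ℝ => Complex.exp (Complex.I * t * (y + s : ℝ)) * η (y + s) :=
    funext (weyl_apply t s η)
  rw [h4, h3.deriv]
  ring

/-- The pairing is the inner product with the conjugate of `η`, hence continuous. This carries
weakly stated relations through infinite sums. -/
theorem hasSum_integral_mul_schwartz {ι : Type*} {f : ι → H} {g : H} (h : HasSum f g)
    (η : 𝓢(ℝ, ℂ)) : HasSum (fun i => ∫ x, f i x * η x) (∫ x, g x * η x) := by
  let e : H := ((η.memLp 2 volume).star).toLp _
  have key : ∀ k : H, ∫ x, k x * η x = innerSL ℂ e k := by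
    intro k
    rw [innerSL_apply_apply, L2.inner_def]
    refine integral_congr_ae ?_
    filter_upwards [((η.memLp 2 volume).star).coeFn_toLp] with x hx
    rw [RCLike.inner_apply, hx]
    simp
  simp_rw [key]
  exact h.mapL _

/-! ### The graphs of position and momentum -/

/-- `g(x) = x f(x)` almost everywhere. -/
def IsPosition (f g : H) : Prop := ∀ᵐ x : ℝ, g x = x * f x

/-- The weak form moves the unbounded factor `x` onto the test function, which makes the graph of
position closed under convergent sums. -/
theorem isPosition_iff_weak {f g : H} :
    IsPosition f g ↔ ∀ η : 𝓢(ℝ, ℂ), ∫ x, g x * η x = ∫ x, f x * xMul η x := by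
  constructor
  · intro h η
    refine integral_congr_ae ?_
    filter_upwards [h] with x hx
    rw [hx, xMul_apply]; ring
  · intro h
    have hloc : LocallyIntegrable (fun x : ℝ => (x : ℂ) * f x) := by
      rw [locallyIntegrable_iff]
      intro K hK
      exact IntegrableOn.continuousOn_mul Complex.continuous_ofReal.continuousOn
        (((Lp.memLp f).locallyIntegrable one_le_two).integrableOn_isCompact hK) hK
    refine ae_eq_of_integral_contDiff_smul_eq
      ((Lp.memLp g).locallyIntegrable one_le_two) hloc fun u hu hs => ?_
    have hs' : HasCompactSupport (fun x => (u x : ℂ)) :=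
      hs.comp_left (g := fun y : ℝ => (y : ℂ)) rfl
    have hu' : ContDiff ℝ ∞ (fun x => (u x : ℂ)) := Complex.ofRealCLM.contDiff.comp hu
    have h1 := h (hs'.toSchwartzMap hu')
    refine Eq.trans ?_ (h1.trans ?_)
    · refine integral_congr_ae (Eventually.of_forall fun x => ?_)
      simp [mul_comm]
    · refine integral_congr_ae (Eventually.of_forall fun x => ?_)
      simp only [xMul_apply]
      simp
      ring

theorem IsPosition.hasSum {ι : Type*} {f g : ι → H} {f' g' : H} (h : ∀ i, IsPosition (f i) (g i))
    (hf : HasSum f f') (hg : HasSum g g') : IsPosition f' g' := by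
  rw [isPosition_iff_weak]
  intro η
  refine (hasSum_integral_mul_schwartz hg η).unique ?_
  simp_rw [isPosition_iff_weak.1 (h _) η]
  exact hasSum_integral_mul_schwartz hf (xMul η)

theorem IsPosition.smul {f g : H} (h : IsPosition f g) (c : ℂ) : IsPosition (c • f) (c • g) := by
  filter_upwards [h, Lp.coeFn_smul c f, Lp.coeFn_smul c g] with x h1 h2 h3
  rw [h3, h2, Pi.smul_apply, Pi.smul_apply, h1, smul_eq_mul, smul_eq_mul]
  ring

/-- Modulation commutes with `x`; translation by `k₂ a` shifts it. -/
theorem IsPosition.latticeOp {f g : H} (h : IsPosition f g) (a : ℝ) (k : ℤ × ℤ) :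
    IsPosition (latticeOp a k f)
      (latticeOp a k g + ((k.2 * a : ℝ) : ℂ) • latticeOp a k f) := by
  filter_upwards [ae_sub_of_ae (k.2 * a) h, coeFn_latticeOp a k f, coeFn_latticeOp a k g,
    Lp.coeFn_add (CoherentON.latticeOp a k g) (((k.2 * a : ℝ) : ℂ) • CoherentON.latticeOp a k f),
    Lp.coeFn_smul (((k.2 * a : ℝ) : ℂ)) (CoherentON.latticeOp a k f)] with x h1 h2 h3 h4 h5
  rw [h4, Pi.add_apply, h5, Pi.smul_apply, h3, h2, h1, smul_eq_mul]
  push_cast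
  ring

theorem IsWeakDeriv.hasSum {ι : Type*} {f g : ι → H} {f' g' : H}
    (h : ∀ i, IsWeakDeriv (f i) (g i)) (hf : HasSum f f') (hg : HasSum g g') :
    IsWeakDeriv f' g' := by
  intro η
  refine (hasSum_integral_mul_schwartz hf (SchwartzMap.derivCLM ℂ ℂ η)).unique ?_
  have := (hasSum_integral_mul_schwartz hg η).neg
  simp_rw [← h _ η] at this
  exact this

theorem IsWeakDeriv.latticeOp {f g : H} (h : IsWeakDeriv f g) (a : ℝ) (k : ℤ × ℤ) :
    IsWeakDeriv (latticeOp a k f)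
      (latticeOp a k g + (Complex.I * ((k.1 * a : ℝ) : ℂ)) • latticeOp a k f) := by
  intro η
  set t : ℝ := k.1 * a
  set s : ℝ := k.2 * a
  -- A change of variables: the transpose of the lattice operator acts on test functions as `weyl t
  -- s`, so the weak derivative of `f` can be tested against `weyl t s η`.
  have hpair : ∀ (u : H) (ζ : ℝ → ℂ), ∫ x, CoherentON.latticeOp a k u x * ζ x =
      ∫ x, u x * (Complex.exp (Complex.I * t * (x + s : ℝ)) * ζ (x + s)) := by
    intro u ζ
    rw [← integral_sub_right_eq_self (fun x : ℝ =>
      u x * (Complex.exp (Complex.I * t * (x + s : ℝ)) * ζ (x + s))) s]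
    refine integral_congr_ae ?_
    filter_upwards [coeFn_latticeOp a k u] with x hx
    rw [hx, sub_add_cancel]
    ring
  have hw := h (weyl t s η)
  have e1 : ∫ x, CoherentON.latticeOp a k f x * deriv η x =
      ∫ x, (f x * deriv (weyl t s η) x - Complex.I * t * (f x * weyl t s η x)) := by
    rw [hpair]
    refine integral_congr_ae (Eventually.of_forall fun x => ?_)
    simp only [deriv_weyl]
    ring
  have e2 : ∫ x, (CoherentON.latticeOp a k g +
      (Complex.I * (t : ℂ)) • CoherentON.latticeOp a k f : H) x * η x =
      ∫ x, (CoherentON.latticeOp a k g x * η x +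
        Complex.I * t * (CoherentON.latticeOp a k f x * η x)) := by
    refine integral_congr_ae ?_
    filter_upwards [Lp.coeFn_add (CoherentON.latticeOp a k g)
      ((Complex.I * (t : ℂ)) • CoherentON.latticeOp a k f),
      Lp.coeFn_smul (Complex.I * (t : ℂ)) (CoherentON.latticeOp a k f)] with x h1 h2
    rw [h1, Pi.add_apply, h2, Pi.smul_apply, smul_eq_mul]
    ring
  rw [e1, e2, integral_sub (integrable_mul_deriv_schwartz f _)
    ((integrable_mul_schwartz f _).const_mul _), integral_add (integrable_mul_schwartz _ η)
    ((integrable_mul_schwartz _ η).const_mul _), integral_const_mul, integral_const_mul, hpair,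
    hpair, hw]
  simp_rw [weyl_apply]
  ring

/-- The square integrable function given by a Schwartz function. -/
def ofSchwartz (s : 𝓢(ℝ, ℂ)) : H := s.toLp 2

theorem coeFn_ofSchwartz (s : 𝓢(ℝ, ℂ)) : ofSchwartz s =ᵐ[volume] s := s.coeFn_toLp 2

theorem isPosition_ofSchwartz (s : 𝓢(ℝ, ℂ)) : IsPosition (ofSchwartz s) (ofSchwartz (xMul s)) := by
  filter_upwards [coeFn_ofSchwartz s, coeFn_ofSchwartz (xMul s)] with x h1 h2
  rw [h1, h2, xMul_apply]

theorem isWeakDeriv_ofSchwartz (s : 𝓢(ℝ, ℂ)) :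
    IsWeakDeriv (ofSchwartz s) (ofSchwartz (SchwartzMap.derivCLM ℂ ℂ s)) := by
  intro η
  have e1 : ∫ x, ofSchwartz s x * deriv η x = ∫ x, s x * deriv η x := by
    refine integral_congr_ae ?_
    filter_upwards [coeFn_ofSchwartz s] with x h
    rw [h]
  have e2 : ∫ x, ofSchwartz (SchwartzMap.derivCLM ℂ ℂ s) x * η x = ∫ x, deriv s x * η x := by
    refine integral_congr_ae ?_
    filter_upwards [coeFn_ofSchwartz (SchwartzMap.derivCLM ℂ ℂ s)] with x h
    rw [h, SchwartzMap.derivCLM_apply]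
  rw [e1, e2, SchwartzMap.integral_mul_deriv_eq_neg_deriv_mul]

theorem dense_range_ofSchwartz : DenseRange ofSchwartz :=
  SchwartzMap.denseRange_toLpCLM (E := ℝ) (F := ℂ) (p := 2) (μ := volume) (by norm_num)

/-! ### The Gaussian as a Schwartz function -/

theorem pow_mul_exp_neg_sq_div_two_le (n : ℕ) (x : ℝ) :
    |x| ^ n * Real.exp (-(x ^ 2 / 2)) ≤ n.factorial * Real.exp (1 / 2) := by
  have h1 := Real.pow_div_factorial_le_exp |x| (abs_nonneg x) n
  rw [div_le_iff₀ (by positivity)] at h1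
  calc |x| ^ n * Real.exp (-(x ^ 2 / 2))
      ≤ Real.exp |x| * n.factorial * Real.exp (-(x ^ 2 / 2)) := by gcongr
    _ = n.factorial * Real.exp (|x| + -(x ^ 2 / 2)) := by rw [Real.exp_add]; ring
    _ ≤ n.factorial * Real.exp (1 / 2) := by
      gcongr
      -- The maximum of `|x| - x²/2` is `1/2`, attained at `|x| = 1`.
      nlinarith [sq_nonneg (|x| - 1), sq_abs x]

theorem exists_abs_pow_mul_poly_mul_exp_le (p : Polynomial ℝ) (k : ℕ) :
    ∃ M : ℝ, ∀ x : ℝ, |x| ^ k * |p.eval x * Real.exp (-(x ^ 2 / 2))| ≤ M := by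
  refine ⟨∑ i ∈ Finset.range (p.natDegree + 1),
    |p.coeff i| * ((k + i).factorial * Real.exp (1 / 2)), fun x => ?_⟩
  rw [Polynomial.eval_eq_sum_range, abs_mul, Real.abs_exp]
  calc |x| ^ k * (|∑ i ∈ Finset.range (p.natDegree + 1), p.coeff i * x ^ i| *
        Real.exp (-(x ^ 2 / 2)))
      ≤ |x| ^ k * ((∑ i ∈ Finset.range (p.natDegree + 1), |p.coeff i * x ^ i|) *
        Real.exp (-(x ^ 2 / 2))) := by
        gcongr; exact Finset.abs_sum_le_sum_abs _ _
    _ = ∑ i ∈ Finset.range (p.natDegree + 1),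
        |p.coeff i| * (|x| ^ (k + i) * Real.exp (-(x ^ 2 / 2))) := by
        rw [Finset.sum_mul, Finset.mul_sum]
        refine Finset.sum_congr rfl fun i _ => ?_
        rw [abs_mul, abs_pow, pow_add]; ring
    _ ≤ _ := by
        refine Finset.sum_le_sum fun i _ => ?_
        exact mul_le_mul_of_nonneg_left (pow_mul_exp_neg_sq_div_two_le _ _) (abs_nonneg _)

/-- The Gaussian `e^{-x²/2}`. -/
def gaussian : 𝓢(ℝ, ℝ) where
  toFun x := Real.exp (-(x ^ 2 / 2))
  smooth' := by fun_prop
  decay' k n := by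
    -- The `n`-th derivative is, up to sign, the `n`-th Hermite polynomial times the Gaussian.
    obtain ⟨M, hM⟩ := exists_abs_pow_mul_poly_mul_exp_le
      ((Polynomial.hermite n).map (Int.castRingHom ℝ)) k
    refine ⟨M, fun x => (le_of_eq ?_).trans (hM x)⟩
    rw [norm_iteratedFDeriv_eq_norm_iteratedDeriv, iteratedDeriv_eq_iterate,
      Polynomial.deriv_gaussian_eq_hermite_mul_gaussian, Real.norm_eq_abs, Real.norm_eq_abs,
      mul_assoc, abs_mul, abs_pow, abs_neg, abs_one, one_pow, one_mul, Polynomial.eval_map,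
      Polynomial.aeval_def]
    rfl

/-- The vacuum as a Schwartz function. -/
def vacuumSchwartz : 𝓢(ℝ, ℂ) :=
  ((Real.pi ^ (-(1 / 4) : ℝ) : ℝ) : ℂ) • SchwartzMap.postcompCLM (𝕜 := ℝ) Complex.ofRealCLM gaussian

theorem vacuumSchwartz_apply (x : ℝ) :
    vacuumSchwartz x = ((Real.pi ^ (-(1 / 4) : ℝ) * Real.exp (-x ^ 2 / 2) : ℝ) : ℂ) := by
  have : gaussian x = Real.exp (-x ^ 2 / 2) := by rw [neg_div]; rfl
  rw [vacuumSchwartz, smul_apply, SchwartzMap.postcompCLM_apply, this,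
    Complex.ofReal_mul]
  rfl

theorem vacuum_eq_ofSchwartz : vacuum = ofSchwartz vacuumSchwartz := by
  refine Lp.ext ?_
  filter_upwards [coeFn_vacuum, coeFn_ofSchwartz vacuumSchwartz] with x h1 h2
  rw [h1, h2, vacuumSchwartz_apply]

theorem deriv_vacuumSchwartz (x : ℝ) :
    deriv vacuumSchwartz x = -x * vacuumSchwartz x := by
  have h : ⇑vacuumSchwartz = fun x : ℝ =>
      ((Real.pi ^ (-(1 / 4) : ℝ) * Real.exp (-x ^ 2 / 2) : ℝ) : ℂ) := funext vacuumSchwartz_apply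
  have h1 : HasDerivAt (fun x : ℝ => Real.pi ^ (-(1 / 4) : ℝ) * Real.exp (-x ^ 2 / 2))
      (Real.pi ^ (-(1 / 4) : ℝ) * (Real.exp (-x ^ 2 / 2) * (-(2 * x ^ 1 * 1) / 2))) x :=
    ((((hasDerivAt_id x).pow 2).neg.div_const 2).exp).const_mul _
  rw [h, h1.ofReal_comp.deriv]
  push_cast
  ring

/-! ### Values of partial operators -/

/-- `x` lies in the domain of `A` and `A x = y`. -/
def Maps (A : H →ₗ.[ℂ] H) (x y : H) : Prop := ∃ h : x ∈ A.domain, A ⟨x, h⟩ = y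

theorem Maps.congr {A : H →ₗ.[ℂ] H} {x y y' : H} (h : Maps A x y) (e : y = y') : Maps A x y' :=
  e ▸ h

theorem Maps.add_vec {A : H →ₗ.[ℂ] H} {x y x' y' : H} (h : Maps A x y) (h' : Maps A x' y') :
    Maps A (x + x') (y + y') := by
  obtain ⟨h, rfl⟩ := h
  obtain ⟨h', rfl⟩ := h'
  exact ⟨A.domain.add_mem h h', A.map_add ⟨x, h⟩ ⟨x', h'⟩⟩

theorem Maps.smul_vec {A : H →ₗ.[ℂ] H} {x y : H} (h : Maps A x y) (c : ℂ) :
    Maps A (c • x) (c • y) := by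
  obtain ⟨h, rfl⟩ := h
  exact ⟨A.domain.smul_mem c h, A.map_smul c ⟨x, h⟩⟩

theorem maps_add {A A' : H →ₗ.[ℂ] H} {x w : H} :
    Maps (A + A') x w ↔ ∃ y y', Maps A x y ∧ Maps A' x y' ∧ w = y + y' := by
  constructor
  · rintro ⟨h, rfl⟩
    exact ⟨_, _, ⟨h.1, rfl⟩, ⟨h.2, rfl⟩, rfl⟩
  · rintro ⟨_, _, ⟨h, rfl⟩, ⟨h', rfl⟩, rfl⟩
    exact ⟨⟨h, h'⟩, rfl⟩

theorem maps_sub {A A' : H →ₗ.[ℂ] H} {x w : H} :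
    Maps (A - A') x w ↔ ∃ y y', Maps A x y ∧ Maps A' x y' ∧ w = y - y' := by
  constructor
  · rintro ⟨h, rfl⟩
    exact ⟨_, _, ⟨h.1, rfl⟩, ⟨h.2, rfl⟩, rfl⟩
  · rintro ⟨_, _, ⟨h, rfl⟩, ⟨h', rfl⟩, rfl⟩
    exact ⟨⟨h, h'⟩, rfl⟩

theorem maps_smul {A : H →ₗ.[ℂ] H} {c : ℂ} {x w : H} :
    Maps (c • A) x w ↔ ∃ y, Maps A x y ∧ w = c • y := by
  constructor
  · rintro ⟨h, rfl⟩
    exact ⟨_, ⟨h, rfl⟩, rfl⟩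
  · rintro ⟨_, ⟨h, rfl⟩, rfl⟩
    exact ⟨h, rfl⟩

theorem maps_pcomp {A A' : H →ₗ.[ℂ] H} {x w : H} :
    Maps (pcomp A A') x w ↔ ∃ y, Maps A' x y ∧ Maps A y w := by
  constructor
  · rintro ⟨h, rfl⟩
    exact ⟨_, ⟨h.1, rfl⟩, ⟨h.2, rfl⟩⟩
  · rintro ⟨_, ⟨h, rfl⟩, ⟨h', rfl⟩⟩
    exact ⟨⟨h, h'⟩, rfl⟩

theorem maps_ofBounded {T : H →L[ℂ] H} {x w : H} : Maps (ofBounded T) x w ↔ w = T x := by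
  constructor
  · rintro ⟨h, rfl⟩
    rfl
  · rintro rfl
    exact ⟨trivial, rfl⟩

theorem Maps.expect_eq {A : H →ₗ.[ℂ] H} {ψ y : H} (h : Maps A ψ y) : expect A ψ = ⟪ψ, y⟫_ℂ := by
  obtain ⟨h, rfl⟩ := h
  rw [expect, dif_pos h]

theorem maps_adjoint {A : H →ₗ.[ℂ] H} (hA : Dense (A.domain : Set H)) {f g : H} :
    Maps A.adjoint f g ↔ ∀ h w, Maps A h w → ⟪g, h⟫_ℂ = ⟪f, w⟫_ℂ := by
  constructor
  · rintro ⟨hf, rfl⟩ h w ⟨hh, rfl⟩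
    exact LinearPMap.adjoint_isFormalAdjoint hA ⟨f, hf⟩ ⟨h, hh⟩
  · intro H'
    have hf : f ∈ A.adjoint.domain :=
      LinearPMap.mem_adjoint_domain_of_exists f ⟨g, fun x => H' x _ ⟨x.2, rfl⟩⟩
    exact ⟨hf, LinearPMap.adjoint_apply_eq hA ⟨f, hf⟩ fun x => H' x _ ⟨x.2, rfl⟩⟩

/-! ### The uncertainty product of an eigenvector -/

/-- The variance of a symmetric operator. -/
theorem variance_eq_of_symmetric {A : H →ₗ.[ℂ] H}
    (hA : ∀ f g f' g', Maps A f g → Maps A f' g' → ⟪g, f'⟫_ℂ = ⟪f, g'⟫_ℂ) {ψ v w : H}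
    (h : Maps A ψ v) (h' : Maps A v w) : variance A ψ = ⟪v, v⟫_ℂ - ⟪ψ, v⟫_ℂ ^ 2 := by
  rw [variance, (maps_pcomp.2 ⟨v, h, h'⟩).expect_eq, h.expect_eq, hA _ _ _ _ h h']

/-- The eigenvalue equation fixes `⟨ψ, u⟩` to be the conjugate of `ζ`, so every expectation depends
only on `ζ` and `‖u‖`. The terms in `ζ²` and its conjugate cancel in each variance, making the two
variances equal; their product then needs no inequality. -/
theorem uncertainty_of_eigenvector {A : H →ₗ.[ℂ] H} (hA : Dense (A.domain : Set H))
    {ψ u p r : H} {ζ : ℂ} (hψ : ‖ψ‖ = 1) (h1 : Maps A ψ (ζ • ψ)) (h2 : Maps A.adjoint ψ u)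
    (h3 : Maps A u p) (h4 : Maps A.adjoint u r) {S T : H →ₗ.[ℂ] H}
    (hS : S = ((1 / Real.sqrt 2 : ℝ) : ℂ) • (A + A.adjoint))
    (hT : T = (Complex.I * ((1 / Real.sqrt 2 : ℝ) : ℂ)) • (A.adjoint - A)) :
    ψ ∈ (pcomp S S).domain ∧ ψ ∈ (pcomp T T).domain ∧
      ((variance S ψ).im = 0 ∧ 0 ≤ (variance S ψ).re) ∧
      ((variance T ψ).im = 0 ∧ 0 ≤ (variance T ψ).re) ∧
      ∃ h : ψ ∈ (comm A A.adjoint).domain,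
        ((uncertainty S ψ * uncertainty T ψ : ℝ) : ℂ) =
          1 / 2 * ⟪ψ, comm A A.adjoint ⟨ψ, h⟩⟫_ℂ := by
  set σ : ℂ := ((1 / Real.sqrt 2 : ℝ) : ℂ) with hσ
  have hσc : starRingEnd ℂ σ = σ := Complex.conj_ofReal _
  have hσ2 : σ * σ = 1 / 2 := by
    rw [hσ, ← Complex.ofReal_mul]
    have : (1 / Real.sqrt 2) * (1 / Real.sqrt 2) = 1 / 2 := by
      rw [div_mul_div_comm, Real.mul_self_sqrt zero_le_two, one_mul]
    rw [this]; norm_num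
  have hadj : ∀ f g f' g', Maps A.adjoint f g → Maps A f' g' → ⟪g, f'⟫_ℂ = ⟪f, g'⟫_ℂ :=
    fun f g f' g' h h' => (maps_adjoint hA).1 h f' g' h'
  have hadj' : ∀ f g f' g', Maps A f g → Maps A.adjoint f' g' → ⟪g, f'⟫_ℂ = ⟪f, g'⟫_ℂ :=
    fun f g f' g' h h' => by
      rw [← inner_conj_symm, ← inner_conj_symm f g', hadj f' g' f g h' h]
  have hSsymm : ∀ f g f' g', Maps S f g → Maps S f' g' → ⟪g, f'⟫_ℂ = ⟪f, g'⟫_ℂ := by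
    intro f g f' g' h h'
    subst hS
    obtain ⟨_, k, rfl⟩ := maps_smul.1 h
    obtain ⟨y, y', hy, hy', rfl⟩ := maps_add.1 k
    obtain ⟨_, k', rfl⟩ := maps_smul.1 h'
    obtain ⟨x, x', hx, hx', rfl⟩ := maps_add.1 k'
    rw [inner_smul_left, inner_smul_right, hσc, inner_add_left, inner_add_right,
      hadj _ _ _ _ hy' hx, hadj' _ _ _ _ hy hx', add_comm]
  have hTsymm : ∀ f g f' g', Maps T f g → Maps T f' g' → ⟪g, f'⟫_ℂ = ⟪f, g'⟫_ℂ := by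
    intro f g f' g' h h'
    subst hT
    obtain ⟨_, k, rfl⟩ := maps_smul.1 h
    obtain ⟨y, y', hy, hy', rfl⟩ := maps_sub.1 k
    obtain ⟨_, k', rfl⟩ := maps_smul.1 h'
    obtain ⟨x, x', hx, hx', rfl⟩ := maps_sub.1 k'
    rw [inner_smul_left, inner_smul_right, map_mul, hσc, Complex.conj_I, inner_sub_left,
      inner_sub_right, hadj _ _ _ _ hy hx', hadj' _ _ _ _ hy' hx]
    ring
  have hS1 : Maps S ψ (σ • (ζ • ψ + u)) :=
    hS ▸ maps_smul.2 ⟨_, maps_add.2 ⟨_, _, h1, h2, rfl⟩, rfl⟩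
  have hT1 : Maps T ψ ((Complex.I * σ) • (u - ζ • ψ)) :=
    hT ▸ maps_smul.2 ⟨_, maps_sub.2 ⟨_, _, h2, h1, rfl⟩, rfl⟩
  have hSu : Maps S u (σ • (p + r)) :=
    hS ▸ maps_smul.2 ⟨_, maps_add.2 ⟨_, _, h3, h4, rfl⟩, rfl⟩
  have hTu : Maps T u ((Complex.I * σ) • (r - p)) :=
    hT ▸ maps_smul.2 ⟨_, maps_sub.2 ⟨_, _, h4, h3, rfl⟩, rfl⟩
  have hS2 := ((hS1.smul_vec ζ).add_vec hSu).smul_vec σ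
  have hT2 := (hTu.add_vec (hT1.smul_vec (-ζ))).smul_vec (Complex.I * σ)
  rw [neg_smul, ← sub_eq_add_neg] at hT2
  have hψψ : ⟪ψ, ψ⟫_ℂ = 1 := by rw [inner_self_eq_norm_sq_to_K, hψ]; norm_num
  have hψu : ⟪ψ, u⟫_ℂ = starRingEnd ℂ ζ := by
    rw [← hadj' _ _ _ _ h1 h2, inner_smul_left, hψψ, mul_one]
  have huψ : ⟪u, ψ⟫_ℂ = ζ := by rw [← inner_conj_symm, hψu, Complex.conj_conj]
  -- `D` is the expectation of the commutator and twice each variance; Cauchy–Schwarz for `⟨u, ψ⟩ =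
  -- ζ` makes it nonnegative.
  set D : ℝ := ‖u‖ ^ 2 - ‖ζ‖ ^ 2 with hD
  have hD0 : 0 ≤ D := by
    have : ‖ζ‖ ≤ ‖u‖ := by
      have := norm_inner_le_norm (𝕜 := ℂ) u ψ
      rwa [huψ, hψ, mul_one] at this
    have := pow_le_pow_left₀ (norm_nonneg ζ) this 2
    linarith
  have huu : ⟪u, u⟫_ℂ = (D : ℂ) + ζ * starRingEnd ℂ ζ := by
    rw [inner_self_eq_norm_sq_to_K, hD, Complex.mul_conj, Complex.normSq_eq_norm_sq]
    push_cast
    simp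
  have hvS : variance S ψ = ((D / 2 : ℝ) : ℂ) := by
    rw [variance_eq_of_symmetric hSsymm hS1 hS2]
    simp only [inner_smul_left, inner_smul_right, inner_add_left, inner_add_right, hσc, hψψ, hψu,
      huψ, huu]
    push_cast
    linear_combination (D + 2 * ζ * starRingEnd ℂ ζ + ζ ^ 2 + starRingEnd ℂ ζ ^ 2
      - (ζ + starRingEnd ℂ ζ) ^ 2) * hσ2
  have hvT : variance T ψ = ((D / 2 : ℝ) : ℂ) := by
    rw [variance_eq_of_symmetric hTsymm hT1 hT2]
    simp only [inner_smul_left, inner_smul_right, inner_sub_left, inner_sub_right, map_mul, hσc,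
      Complex.conj_I, hψψ, hψu, huψ, huu]
    push_cast
    linear_combination (D + 2 * ζ * starRingEnd ℂ ζ - ζ ^ 2 - starRingEnd ℂ ζ ^ 2
      + (starRingEnd ℂ ζ - ζ) ^ 2) * hσ2 - σ ^ 2 *
      ((D + 2 * ζ * starRingEnd ℂ ζ - ζ ^ 2 - starRingEnd ℂ ζ ^ 2) +
        (starRingEnd ℂ ζ - ζ) ^ 2) * Complex.I_sq
  -- Here `A A† ψ = p` and `A† A ψ = ζ u`; below, `⟨ψ, p⟩` becomes `⟨u, u⟩` by adjointness.
  have hcomm : Maps (comm A A.adjoint) ψ (p - ζ • u) :=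
    maps_sub.2 ⟨_, _, maps_pcomp.2 ⟨_, h2, h3⟩, maps_pcomp.2 ⟨_, h1, h2.smul_vec ζ⟩, rfl⟩
  refine ⟨(maps_pcomp.2 ⟨_, hS1, hS2⟩).1, (maps_pcomp.2 ⟨_, hT1, hT2⟩).1, ?_, ?_, ?_⟩
  · rw [hvS]
    exact ⟨Complex.ofReal_im _, by rw [Complex.ofReal_re]; positivity⟩
  · rw [hvT]
    exact ⟨Complex.ofReal_im _, by rw [Complex.ofReal_re]; positivity⟩
  · obtain ⟨h, he⟩ := hcomm
    refine ⟨h, ?_⟩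
    rw [he, uncertainty, uncertainty, hvS, hvT, Complex.ofReal_re,
      Real.mul_self_sqrt (by positivity), inner_sub_right, inner_smul_right,
      ← hadj _ _ _ _ h2 h3, hψu, huu]
    push_cast
    ring

/-! ### The annihilation operator and its formal adjoint -/

/-- The constant `1/√2`. -/
def σ : ℂ := ((1 / Real.sqrt 2 : ℝ) : ℂ)

theorem conj_σ : starRingEnd ℂ σ = σ := Complex.conj_ofReal _

theorem maps_position {f g : H} : Maps position f g ↔ IsPosition f g := by
  constructor
  · rintro ⟨h, rfl⟩
    exact MemLp.coeFn_toLp h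
  · intro h
    have hm : MemLp (fun x : ℝ => (x : ℂ) * f x) 2 volume := (Lp.memLp g).ae_eq h
    refine ⟨hm, Lp.ext ?_⟩
    filter_upwards [MemLp.coeFn_toLp hm, h] with x h1 h2
    rw [h2]
    exact h1

theorem maps_I_smul_momentum {f g : H} : Maps (Complex.I • momentum) f g ↔ IsWeakDeriv f g := by
  have key : ∀ v : H, Complex.I • (-Complex.I • v) = v := fun v => by
    rw [smul_smul, mul_neg, Complex.I_mul_I, neg_neg, one_smul]
  constructor
  · rintro ⟨h, rfl⟩
    have h' : ∃ g, IsWeakDeriv f g := h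
    have e : (Complex.I • momentum) ⟨f, h⟩ = h'.choose := key _
    rw [e]
    exact h'.choose_spec
  · intro h
    have h' : ∃ g, IsWeakDeriv f g := ⟨g, h⟩
    exact ⟨h', (key _).trans (h'.choose_spec.unique h)⟩

theorem maps_annihilation {f w : H} : Maps annihilation f w ↔
    ∃ g g', IsPosition f g ∧ IsWeakDeriv f g' ∧ w = σ • (g + g') := by
  rw [annihilation, maps_smul]
  simp only [maps_add, maps_position, maps_I_smul_momentum]
  constructor
  · rintro ⟨_, ⟨g, g', h, h', rfl⟩, rfl⟩
    exact ⟨g, g', h, h', rfl⟩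
  · rintro ⟨g, g', h, h', rfl⟩
    exact ⟨_, ⟨g, g', h, h', rfl⟩, rfl⟩

/-- `f` lies in the domain of the adjoint of the annihilation operator, with value `g`. -/
def IsCreation (f g : H) : Prop := ∀ h w, Maps annihilation h w → ⟪g, h⟫_ℂ = ⟪f, w⟫_ℂ

theorem IsCreation.smul {f g : H} (h : IsCreation f g) (c : ℂ) : IsCreation (c • f) (c • g) :=
  fun x w hx => by rw [inner_smul_left, inner_smul_left, h x w hx]

theorem IsCreation.add {f g f' g' : H} (h : IsCreation f g) (h' : IsCreation f' g') :
    IsCreation (f + f') (g + g') :=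
  fun x w hx => by rw [inner_add_left, inner_add_left, h x w hx, h' x w hx]

theorem hasSum_inner_left {ι : Type*} {f : ι → H} {f' : H} (h : HasSum f f') (g : H) :
    HasSum (fun i => ⟪f i, g⟫_ℂ) ⟪f', g⟫_ℂ := by
  have := (h.mapL (innerSL ℂ g)).map (starRingEnd ℂ) Complex.continuous_conj
  simpa [Function.comp_def, inner_conj_symm] using this

theorem IsCreation.hasSum {ι : Type*} {f g : ι → H} {f' g' : H}
    (h : ∀ i, IsCreation (f i) (g i)) (hf : HasSum f f') (hg : HasSum g g') :
    IsCreation f' g' := fun x w hx => by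
  refine (hasSum_inner_left hg x).unique ?_
  simp_rw [h _ x w hx]
  exact hasSum_inner_left hf w

theorem z_eq (a : ℝ) (k : ℤ × ℤ) :
    z a k = σ * (((k.2 * a : ℝ) : ℂ) + Complex.I * ((k.1 * a : ℝ) : ℂ)) := by
  rw [z, σ]
  push_cast
  ring

/-- The displacement relation `b T(k) = T(k) b + z_k T(k)`: the position shift `k₂ a` and the
derivative shift `i k₁ a` combine into `z_k`. -/
theorem maps_annihilation_latticeOp {f w : H} (h : Maps annihilation f w) (a : ℝ) (k : ℤ × ℤ) :
    Maps annihilation (latticeOp a k f) (latticeOp a k w + z a k • latticeOp a k f) := by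
  obtain ⟨g, g', hg, hg', rfl⟩ := maps_annihilation.1 h
  refine maps_annihilation.2 ⟨_, _, hg.latticeOp a k, hg'.latticeOp a k, ?_⟩
  rw [map_smul, map_add, z_eq]
  module

theorem z_neg (a : ℝ) (k : ℤ × ℤ) : z a (-k) = -z a k := by
  rw [z, z]
  push_cast [Prod.fst_neg, Prod.snd_neg]
  ring

/-- Adjoint of the displacement relation, obtained by testing against vectors displaced by `-k`. -/
theorem IsCreation.latticeOp {L : ℕ} {a : ℝ} (ha : a ^ 2 = 2 * Real.pi * L) {f g : H}
    (h : IsCreation f g) (k : ℤ × ℤ) :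
    IsCreation (latticeOp a k f)
      (latticeOp a k g + starRingEnd ℂ (z a k) • latticeOp a k f) := by
  intro x w hx
  have h1 := h _ _ (maps_annihilation_latticeOp hx a (-k))
  rw [inner_add_right, inner_smul_right, z_neg] at h1
  rw [inner_add_left, inner_smul_left, Complex.conj_conj, inner_latticeOp_left ha,
    inner_latticeOp_left ha, inner_latticeOp_left ha, h1]
  ring

/-- Shared by position, weak derivative and creation: passing `T(k)` costs a scalar `μ k`, and the
series of corrections converges because `μ k * d k` still decays rapidly. -/
theorem rel_synth {R : H → H → Prop} {a : ℝ}
    (hsum : ∀ {f g : ℤ × ℤ → H} {f' g' : H}, (∀ i, R (f i) (g i)) → HasSum f f' → HasSum g g' →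
      R f' g') (hsmul : ∀ {f g : H} (c : ℂ), R f g → R (c • f) (c • g)) {μ : ℤ × ℤ → ℂ} {v w : H}
    (hlat : ∀ k, R (latticeOp a k v) (latticeOp a k w + μ k • latticeOp a k v)) {d : ℤ × ℤ → ℂ}
    (hd : RapidDecay d) (hd' : RapidDecay fun k => μ k * d k) :
    R (synth (latticeOp a) d v)
      (synth (latticeOp a) d w + synth (latticeOp a) (fun k => μ k * d k) v) := by
  refine hsum (fun k => hsmul (d k) (hlat k)) (hasSum_synth_latticeOp a hd.summable_norm v) ?_
  refine ((hasSum_synth_latticeOp a hd.summable_norm w).add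
    (hasSum_synth_latticeOp a hd'.summable_norm v)).congr_fun fun k => ?_
  module

theorem RapidDecay.const_mul {d : ℤ × ℤ → ℂ} (hd : RapidDecay d) (c : ℂ) :
    RapidDecay fun k => c * d k := fun N =>
  ((hd N).mul_left ‖c‖).congr fun k => by rw [norm_mul]; ring

theorem RapidDecay.add {d e : ℤ × ℤ → ℂ} (hd : RapidDecay d) (he : RapidDecay e) :
    RapidDecay fun k => d k + e k := fun N =>
  Summable.of_nonneg_of_le (fun _ => by positivity)
    (fun k => by
      rw [← mul_add]
      exact mul_le_mul_of_nonneg_left (norm_add_le _ _) (by positivity)) ((hd N).add (he N))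

theorem RapidDecay.conj_z_mul {d : ℤ × ℤ → ℂ} (hd : RapidDecay d) (a : ℝ) :
    RapidDecay fun k => starRingEnd ℂ (z a k) * d k := by
  have := ((hd.snd_mul.const_mul (σ * a)).add (hd.fst_mul.const_mul (-(σ * Complex.I * a))))
  refine this.of_norm_le_mul (M := 1) fun k => ?_
  have e : starRingEnd ℂ (z a k) * d k =
      σ * a * (k.2 * d k) + -(σ * Complex.I * a) * (k.1 * d k) := by
    rw [z_eq, map_mul, map_add, map_mul, conj_σ, Complex.conj_I, Complex.conj_ofReal,
      Complex.conj_ofReal]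
    push_cast
    ring
  rw [e]
  exact le_mul_of_one_le_left (norm_nonneg _) (by simp)

theorem IsCreation.synth {L : ℕ} {a : ℝ} (ha : a ^ 2 = 2 * Real.pi * L) {f g : H}
    (h : IsCreation f g) {d : ℤ × ℤ → ℂ} (hd : RapidDecay d) :
    IsCreation (synth (CoherentON.latticeOp a) d f) (synth (CoherentON.latticeOp a) d g +
      synth (CoherentON.latticeOp a) (fun k => starRingEnd ℂ (z a k) * d k) f) :=
  rel_synth IsCreation.hasSum (fun c h => h.smul c) (h.latticeOp ha) hd (hd.conj_z_mul a)

/-- Closure under sums is used for position and weak derivative separately, so the limit lies in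
both domains and closedness of `b` itself is not needed. -/
theorem exists_maps_annihilation_synth {a : ℝ} {f w : H} (h : Maps annihilation f w)
    {d : ℤ × ℤ → ℂ} (hd : RapidDecay d) :
    ∃ w', Maps annihilation (synth (latticeOp a) d f) w' := by
  obtain ⟨g, g', hg, hg', rfl⟩ := maps_annihilation.1 h
  have h1 := rel_synth IsPosition.hasSum (fun c h => h.smul c) (hg.latticeOp a) hd
    ((hd.snd_mul.const_mul a).of_norm_le_mul (M := 1) fun k => by
      push_cast
      rw [mul_comm (k.2 : ℂ), mul_assoc]
      exact le_mul_of_one_le_left (norm_nonneg _) (by simp))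
  have h2 := rel_synth IsWeakDeriv.hasSum (fun c h => h.smul c) (hg'.latticeOp a) hd
    ((hd.fst_mul.const_mul (Complex.I * a)).of_norm_le_mul (M := 1) fun k => by
      push_cast
      rw [mul_comm (k.1 : ℂ), ← mul_assoc, mul_assoc]
      exact le_mul_of_one_le_left (norm_nonneg _) (by simp))
  exact ⟨_, maps_annihilation.2 ⟨_, _, h1, h2, rfl⟩⟩

/-! ### Real Schwartz functions -/

theorem inner_ofSchwartz {s : 𝓢(ℝ, ℂ)} (hs : ∀ x, starRingEnd ℂ (s x) = s x) (f : H) :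
    ⟪ofSchwartz s, f⟫_ℂ = ∫ x, f x * s x := by
  rw [L2.inner_def]
  refine integral_congr_ae ?_
  filter_upwards [coeFn_ofSchwartz s] with x hx
  rw [RCLike.inner_apply, hx, hs]

theorem maps_annihilation_ofSchwartz (s : 𝓢(ℝ, ℂ)) : Maps annihilation (ofSchwartz s)
    (σ • (ofSchwartz (xMul s) + ofSchwartz (SchwartzMap.derivCLM ℂ ℂ s))) :=
  maps_annihilation.2 ⟨_, _, isPosition_ofSchwartz s, isWeakDeriv_ofSchwartz s, rfl⟩

/-- The witness is `(x s - s')/√2`. Real-valuedness turns inner products into the bilinear pairings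
in which the weak relations are stated, and it is preserved, so the step can be iterated. -/
theorem exists_isCreation_ofSchwartz {s : 𝓢(ℝ, ℂ)} (hs : ∀ x, starRingEnd ℂ (s x) = s x) :
    ∃ s' : 𝓢(ℝ, ℂ), (∀ x, starRingEnd ℂ (s' x) = s' x) ∧
      IsCreation (ofSchwartz s) (ofSchwartz s') := by
  have hd : ∀ x, starRingEnd ℂ (deriv s x) = deriv s x := by
    intro x
    have h1 : HasDerivAt (fun y => star (s y)) (star (deriv s x)) x :=
      (s.differentiableAt.hasDerivAt).star
    have h2 : (fun y => star (s y)) = s := funext hs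
    rw [h2] at h1
    exact h1.unique s.differentiableAt.hasDerivAt
  have hs' : ∀ x, (σ • (xMul s - SchwartzMap.derivCLM ℂ ℂ s)) x =
      σ * (x * s x - deriv s x) := by
    intro x
    rw [smul_apply, sub_apply, xMul_apply, SchwartzMap.derivCLM_apply, smul_eq_mul]
  have hr : ∀ x, starRingEnd ℂ ((σ • (xMul s - SchwartzMap.derivCLM ℂ ℂ s)) x) =
      (σ • (xMul s - SchwartzMap.derivCLM ℂ ℂ s)) x := by
    intro x
    rw [hs', map_mul, map_sub, map_mul, conj_σ, Complex.conj_ofReal, hs, hd]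
  refine ⟨_, hr, fun f w hf => ?_⟩
  obtain ⟨g, g', hg, hg', rfl⟩ := maps_annihilation.1 hf
  rw [inner_smul_right, inner_add_right, inner_ofSchwartz hr, inner_ofSchwartz hs,
    inner_ofSchwartz hs, isPosition_iff_weak.1 hg s]
  have h1 := hg' s
  have e : ∫ x, f x * (σ • (xMul s - SchwartzMap.derivCLM ℂ ℂ s)) x =
      ∫ x, σ * (f x * xMul s x - f x * deriv s x) := by
    refine integral_congr_ae (Eventually.of_forall fun x => ?_)
    simp only [hs', xMul_apply]
    ring
  rw [e, integral_const_mul, integral_sub (integrable_mul_schwartz f _)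
    (integrable_mul_deriv_schwartz f _), h1, sub_neg_eq_add]

theorem conj_vacuumSchwartz (x : ℝ) : starRingEnd ℂ (vacuumSchwartz x) = vacuumSchwartz x := by
  rw [vacuumSchwartz_apply, Complex.conj_ofReal]

theorem maps_annihilation_vacuum : Maps annihilation vacuum 0 := by
  rw [vacuum_eq_ofSchwartz]
  refine (maps_annihilation_ofSchwartz vacuumSchwartz).congr ?_
  rw [smul_eq_zero]
  right
  refine Lp.ext ?_
  filter_upwards [Lp.coeFn_add (ofSchwartz (xMul vacuumSchwartz))
      (ofSchwartz (SchwartzMap.derivCLM ℂ ℂ vacuumSchwartz)),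
    Lp.coeFn_zero ℂ 2 (volume : Measure ℝ), coeFn_ofSchwartz (xMul vacuumSchwartz),
    coeFn_ofSchwartz (SchwartzMap.derivCLM ℂ ℂ vacuumSchwartz)] with x h1 h2 h3 h4
  rw [h1, h2, Pi.add_apply, h3, h4, xMul_apply, SchwartzMap.derivCLM_apply, deriv_vacuumSchwartz]
  simp

theorem maps_annihilation_φ (a : ℝ) (n : ℤ × ℤ) :
    Maps annihilation (φ a n) (z a n • φ a n) :=
  (maps_annihilation_latticeOp maps_annihilation_vacuum a n).congr (by rw [map_zero, zero_add]; rfl)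

/-- `f` lies in the domains of the annihilation operator and of its adjoint. -/
def Regular (f : H) : Prop := (∃ w, Maps annihilation f w) ∧ ∃ w, IsCreation f w

theorem Regular.add {f g : H} (hf : Regular f) (hg : Regular g) : Regular (f + g) := by
  obtain ⟨⟨_, h1⟩, _, h2⟩ := hf
  obtain ⟨⟨_, h3⟩, _, h4⟩ := hg
  exact ⟨⟨_, h1.add_vec h3⟩, _, h2.add h4⟩

theorem Regular.smul {f : H} (hf : Regular f) (c : ℂ) : Regular (c • f) := by
  obtain ⟨⟨_, h1⟩, _, h2⟩ := hf
  exact ⟨⟨_, h1.smul_vec c⟩, _, h2.smul c⟩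

theorem regular_ofSchwartz {s : 𝓢(ℝ, ℂ)} (hs : ∀ x, starRingEnd ℂ (s x) = s x) :
    Regular (ofSchwartz s) := by
  obtain ⟨_, _, h⟩ := exists_isCreation_ofSchwartz hs
  exact ⟨⟨_, maps_annihilation_ofSchwartz s⟩, _, h⟩

section

variable {L : ℕ} {a : ℝ} (ha : a ^ 2 = 2 * Real.pi * L)

include ha

theorem Regular.latticeOp {f : H} (hf : Regular f) (k : ℤ × ℤ) :
    Regular (CoherentON.latticeOp a k f) := by
  obtain ⟨⟨_, h1⟩, _, h2⟩ := hf
  exact ⟨⟨_, maps_annihilation_latticeOp h1 a k⟩, _, h2.latticeOp ha k⟩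

theorem Regular.synth {f : H} (hf : Regular f) {d : ℤ × ℤ → ℂ} (hd : RapidDecay d) :
    Regular (synth (CoherentON.latticeOp a) d f) := by
  obtain ⟨⟨_, h1⟩, _, h2⟩ := hf
  exact ⟨exists_maps_annihilation_synth h1 hd, _, h2.synth ha hd⟩

theorem regular_φ (n : ℤ × ℤ) : Regular (φ a n) :=
  Regular.latticeOp ha (vacuum_eq_ofSchwartz ▸ regular_ofSchwartz conj_vacuumSchwartz) n

/-- Regularity of the image is what second-order expressions such as `B B†` and `B† B†` require. -/
theorem exists_isCreation_φ (n : ℤ × ℤ) : ∃ e, IsCreation (φ a n) e ∧ Regular e := by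
  obtain ⟨s, hs, h⟩ := exists_isCreation_ofSchwartz conj_vacuumSchwartz
  rw [← vacuum_eq_ofSchwartz] at h
  exact ⟨_, h.latticeOp ha n,
    ((regular_ofSchwartz hs).latticeOp ha n).add ((regular_φ ha n).smul _)⟩

end

/-! ### The operator `B_L` -/

section OperatorB

variable {L : ℕ} (hL : 1 < L) {a : ℝ} (ha : a ^ 2 = 2 * Real.pi * L)

omit hL ha in
theorem maps_B {f w : H} : Maps (B a L) f w ↔
    ∃ y, Maps annihilation (Ring.inverse (X a L) f) y ∧ w = X a L y := by
  simp only [B, maps_pcomp, maps_ofBounded]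
  constructor
  · rintro ⟨y, ⟨_, rfl, h⟩, rfl⟩
    exact ⟨y, h, rfl⟩
  · rintro ⟨y, h, rfl⟩
    exact ⟨y, ⟨_, rfl, h⟩, rfl⟩

include hL ha

theorem maps_B_Ψ (n : ℤ × ℤ) : Maps (B a L) (Ψ a L n) (z a n • Ψ a L n) := by
  refine maps_B.2 ⟨z a n • φ a n, ?_, by rw [map_smul, Ψ]⟩
  rw [Ψ, inverse_X_apply hL ha]
  exact maps_annihilation_φ a n

/-- The domain contains the image of the Schwartz functions under `X`, a continuous surjection, and
so is dense. -/
theorem dense_domain_B : Dense ((B a L).domain : Set H) := by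
  have h : DenseRange fun s => X a L (ofSchwartz s) :=
    DenseRange.comp (Function.Surjective.denseRange fun f => ⟨_, X_inverse_apply hL ha f⟩)
      dense_range_ofSchwartz (X a L).continuous
  refine Dense.mono ?_ h
  rintro _ ⟨s, rfl⟩
  have hs := maps_annihilation_ofSchwartz s
  rw [← inverse_X_apply hL ha (ofSchwartz s)] at hs
  exact (maps_B.2 ⟨_, hs, rfl⟩).1

/-- The inclusion `X⁻¹ b† X ⊆ B†`, which holds because `X` and `X⁻¹` are symmetric; the reverse
inclusion is not needed. -/
theorem maps_adjoint_B {f g : H} (h : IsCreation (X a L f) g) :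
    Maps (B a L).adjoint f (Ring.inverse (X a L) g) := by
  refine (maps_adjoint (dense_domain_B hL ha)).2 fun x w hx => ?_
  obtain ⟨y, hy, rfl⟩ := maps_B.1 hx
  rw [inner_inverse_X_left hL ha, h _ _ hy, inner_X_left hL ha]

/-- Since `X Ψ_n = X² φ_n`, the vector is `u = X⁻¹ y` with `y = b† X² φ_n`, and `y` is a rapidly
convergent lattice series of regular vectors. -/
theorem exists_maps_adjoint_B_Ψ (n : ℤ × ℤ) : ∃ u, Maps (B a L).adjoint (Ψ a L n) u ∧
    (∃ p, Maps (B a L) u p) ∧ ∃ r, Maps (B a L).adjoint u r := by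
  have hc := rapidDecay_c hL
  have hR := hc.conv (rapidDecay_I hL)
  have hφ := regular_φ ha n
  have hX : X a L (Ψ a L n) = synth (latticeOp a) (conv (c L) (c L)) (φ a n) := by
    rw [synth_latticeOp_conv ha hc hc]; rfl
  obtain ⟨e, he, he'⟩ := exists_isCreation_φ ha n
  have hu := he.synth ha (hc.conv hc)
  have hd := (hc.conv hc).conj_z_mul a
  rw [← hX] at hu
  set y := synth (latticeOp a) (conv (c L) (c L)) e +
    synth (latticeOp a) (fun k => starRingEnd ℂ (z a k) * conv (c L) (c L) k) (φ a n)
  have hy : Regular y := (he'.synth ha (hc.conv hc)).add (hφ.synth ha hd)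
  -- Membership of `u` in the domain of `B` asks for `X⁻¹ u = X⁻² y` in the domain of `b`, hence two
  -- applications of the series for `X⁻¹`.
  obtain ⟨⟨w₁, h₁⟩, _⟩ := (hy.synth ha hR).synth ha hR
  rw [← inverse_X hL ha] at h₁
  obtain ⟨_, w₂, h₂⟩ := hy
  refine ⟨_, maps_adjoint_B hL ha hu, ⟨_, maps_B.2 ⟨w₁, h₁, rfl⟩⟩, _,
    maps_adjoint_B hL ha (g := w₂) ?_⟩
  -- For `B†` the condition concerns `X u = y`, where regularity of `y` applies directly.
  rwa [X_inverse_apply hL ha]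

end OperatorB

end CoherentON

end

open CoherentON in
theorem mainTheorem3 (L : ℕ) (hL1 : 1 < L) (a : ℝ) (ha : a ^ 2 = 2 * Real.pi * L) :
    -- the vacuum, and the overlaps of the coherent states
    (∃ h : vacuum ∈ annihilation.domain, annihilation ⟨vacuum, h⟩ = 0) ∧
    (∀ m : ℤ × ℤ, ⟪φ a m, φ a 0⟫_ℂ = I L m) ∧
    -- strict positivity of `F_L`, smoothness of `F_L^{-1/2}`, decay of its Fourier coefficients
    (∀ p : ℝ × ℝ, (F L p).im = 0 ∧ 0 < (F L p).re) ∧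
    ContDiff ℝ ∞ (C L) ∧
    (∀ N : ℕ, Tendsto (fun k : ℤ × ℤ => Real.sqrt ((k.1 : ℝ) ^ 2 + (k.2 : ℝ) ^ 2) ^ N * ‖c L k‖)
      cofinite (𝓝 0)) ∧
    -- the operator `X_L`
    (Summable fun k : ℤ × ℤ => ‖c L k‖) ∧
    IsSelfAdjoint (X a L) ∧
    IsUnit (X a L) ∧
    (∀ f ∈ hL a, X a L f ∈ hL a ∧ Ring.inverse (X a L) f ∈ hL a) ∧
    -- the vectors `Ψ_n`
    (∀ n : ℤ × ℤ, HasSum (fun k : ℤ × ℤ => c L k • φ a (k + n)) (Ψ a L n)) ∧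
    (∀ n : ℤ × ℤ, Ψ a L n ∈ hL a) ∧
    Orthonormal ℂ (Ψ a L) ∧
    (∀ n : ℤ × ℤ, Ψ a L n = latticeOp a n (Ψ a L 0)) ∧
    (∀ n : ℤ × ℤ, T₁ a (Ψ a L n) = Ψ a L (n + (1, 0)) ∧ T₂ a (Ψ a L n) = Ψ a L (n + (0, 1))) ∧
    (Submodule.span ℂ (Set.range (Ψ a L))).topologicalClosure = hL a ∧
    -- the operator `B_L` and the uncertainty relation
    Dense ((B a L).domain : Set H) ∧
    (∀ n : ℤ × ℤ, ∃ h : Ψ a L n ∈ (B a L).domain, B a L ⟨Ψ a L n, h⟩ = z a n • Ψ a L n) ∧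
    (∀ n : ℤ × ℤ,
      Ψ a L n ∈ (pcomp (Q a L) (Q a L)).domain ∧
      Ψ a L n ∈ (pcomp (P a L) (P a L)).domain ∧
      ((variance (Q a L) (Ψ a L n)).im = 0 ∧ 0 ≤ (variance (Q a L) (Ψ a L n)).re) ∧
      ((variance (P a L) (Ψ a L n)).im = 0 ∧ 0 ≤ (variance (P a L) (Ψ a L n)).re) ∧
      ∃ h : Ψ a L n ∈ (comm (B a L) (B a L).adjoint).domain,
        ((uncertainty (Q a L) (Ψ a L n) * uncertainty (P a L) (Ψ a L n) : ℝ) : ℂ) =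
          1 / 2 * ⟪Ψ a L n, comm (B a L) (B a L).adjoint ⟨Ψ a L n, h⟩⟫_ℂ) := by
  have hc := rapidDecay_c hL1
  refine ⟨maps_annihilation_vacuum, inner_φ_φ_zero ha, fun p => ⟨F_im L p, F_re_pos hL1 p⟩,
    contDiff_C hL1, hc.tendsto, hc.summable_norm, isSelfAdjoint_X hL1 ha, isUnit_X hL1 ha,
    fun f hf => ⟨X_mem_hL ha hL1 hf, inverse_X_mem_hL ha hL1 hf⟩, hasSum_Ψ ha hL1,
    fun n => X_mem_hL ha hL1 (φ_mem_hL a n), orthonormal_Ψ ha hL1,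
    fun n => by rw [latticeOp_Ψ ha hL1, add_zero], fun n => ⟨?_, ?_⟩,
    span_Ψ_topologicalClosure ha hL1, dense_domain_B hL1 ha, maps_B_Ψ hL1 ha, fun n => ?_⟩
  · rw [add_comm, ← latticeOp_Ψ ha hL1, latticeOp_apply]
    simp
  · rw [add_comm, ← latticeOp_Ψ ha hL1, latticeOp_apply]
    simp
  · obtain ⟨u, hu, ⟨p, hp⟩, r, hr⟩ := exists_maps_adjoint_B_Ψ hL1 ha n
    exact uncertainty_of_eigenvector (dense_domain_B hL1 ha) ((orthonormal_Ψ ha hL1).norm_eq_one n)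
      (maps_B_Ψ hL1 ha n) hu hp hr rfl rfl
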